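/- Notation. For complex $x$ and integer $n\ge 0$ let $(x)^{(n)}=x(x+1)\cdots(x+n-1)$. For complex parameters, none of the $b_i$ being a non-positive integer, let $${}_pF_q(a_1,\dots,a_p;b_1,\dots,b_q;x)=\sum_{j\ge 0}\frac{(a_1)^{(j)}\cdots(a_p)^{(j)}}{(b_1)^{(j)}\cdots(b_q)^{(j)}}\frac{x^j}{j!},$$ the sum being the limit of the partial sums. For $f,d>0$ let $f(x|f,d)=x^{f-1}(1-x)^{d-1}/B(f,d)$ for $0<x<1$, and $$K_n(x|a,b)=\frac1{n!}\sum_{m=0}^n\binom nm (a+b+n-1)^{(m)}(b+m)^{(n-m)}(x-1)^m .$$ By convention $1/\Gamma(z)=0$ when $z\in\{0,-1,-2,\dots\}$. Theorem. In each part below the integrand is integrable and all the series which occur converge. 1. Let $a,b,c$ be complex with $\operatorname{Re}(c-a-b)>0$ and $c\notin\{0,-1,-2,\dots\}$, let $f,d>0$ and let $j\ge 0$ be an integer. Then $$\int_0^1 {}_2F_1(a,b;c;x)K_j(x|f,d)f(x|f,d)\,dx=\frac{(f)^{(j)}(d)^{(j)}(a)^{(j)}(b)^{(j)}}{j!\,(f+d)^{(2j)}(c)^{(j)}}\;{}_3F_2(a+j,b+j,f+j;c+j,d+f+2j;1).$$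 2. Let $c,d>0$, let $a,b$ be complex with $\operatorname{Re}(c-a-b)>0$, let $j\ge0$ be an integer, and suppose that $(d+c-a)^{(j)}\ne0$ and $(d+c-b)^{(j)}\neq 0$. Then $$\int_0^1 {}_2F_1(a,b;c;x)K_j(x|c,d)f(x|c,d)\,dx=\frac{(d)^{(j)}(a)^{(j)}(b)^{(j)}}{j!\,(d+c-a)^{(j)}(d+c-b)^{(j)}}\cdot\frac{\Gamma(c+d)\Gamma(d+c-a-b)}{\Gamma(d+c-a)\Gamma(d+c-b)}.$$ 3. Let $a,b,c,d$ be complex with $\operatorname{Re}(c-a-b)>0$ and $c+d-a,\ c+d-b\notin\{0,-1,-2,\dots\}$. (i) If $c\notin\{0,-1,-2,\dots\}$, then $$\frac{\Gamma(c)\Gamma(c-a-b)\Gamma(c+d-a)\Gamma(c+d-b)}{\Gamma(c-a)\Gamma(c-b)\Gamma(c+d)\Gamma(c+d-a-b)}={}_4F_3(a,b,d,c+d-1;c,c+d-a,c+d-b;1)$$ $$+\frac{2abd}{c(c+d-a)(c+d-b)}\;{}_4F_3(a+1,b+1,d+1,c+d;c+1,c+d-a+1,c+d-b+1;1).$$ (ii)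 If $\operatorname{Re}(c+d-2a-2b)>-1$, or if at least one of $a+1,\ b+1,\ c+d$ is a non-positive integer, then $$\frac{\Gamma(c+d-a)\Gamma(c+d-b)}{\Gamma(c+d)\Gamma(c+d-a-b)}={}_3F_2(a,b,c+d-1;c+d-a,c+d-b;-1)$$ $$-\frac{2ab}{(c+d-a)(c+d-b)}\;{}_3F_2(a+1,b+1,c+d;c+d-a+1,c+d-b+1;-1).$$ 4. Let $n,m\ge0$ be integers and let $a,b,c$ be complex with $\operatorname{Re}(c-a-b)>0$, such that $c$ is not an integer $\le n+m$ and neither $a$ nor $b$ is an integer in $[1-n,\,n+m]$. Then $${}_3F_2(a+n,b+n,1+n;c+n,1+m+2n;1)=\frac{(2n+m)!\,(c)^{(n)}}{n!\,(a)^{(n)}(b)^{(n)}}\sum_{j=0}^n(-1)^j\binom nj\frac{(n+m)^{(j)}(c-j-m)^{(j+m)}}{(a-j-m)^{(j+m)}(b-j-m)^{(j+m)}}$$ $$\times\left(\frac{\Gamma(c-j-m)\Gamma(c-a-b+m+j)}{\Gamma(c-a)\Gamma(c-b)}-\sum_{k=0}^{j+m-1}\frac{(a-m-j)^{(k)}(b-m-j)^{(k)}}{k!\,(c-m-j)^{(k)}}\right).$$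 -/

import Mathlib

open ProbabilityTheory

/-- The rising factorial `x (x + 1) ⋯ (x + n - 1)`. -/
noncomputable def rising (x : ℂ) (n : ℕ) : ℂ := (ascPochhammer ℂ n).eval x

/-- The `j`-th term of the generalized hypergeometric series with upper parameters `as` and
lower parameters `bs`, at the point `x`. -/
noncomputable def hypTerm (as bs : List ℂ) (x : ℂ) (j : ℕ) : ℂ :=
  (as.map fun a => rising a j).prod / (bs.map fun b => rising b j).prod *
    (x ^ j / (j.factorial : ℂ))

/-- The generalized hypergeometric series converges at `x`: its partial sums
`∑ j < N, hypTerm as bs x j` have a limit (the convergence need not be absolute). -/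
def HypConverges (as bs : List ℂ) (x : ℂ) : Prop :=
  Summable (hypTerm as bs x) (SummationFilter.conditional ℕ)

/-- The generalized hypergeometric function: the limit of the partial sums of its series. -/
noncomputable def hyp (as bs : List ℂ) (x : ℂ) : ℂ :=
  ∑'[SummationFilter.conditional ℕ] j, hypTerm as bs x j

/-- The polynomials `K_n(x|a,b)`, Jacobi polynomials orthogonal on `[0, 1]` with respect to the
beta density with parameters `a`, `b` when these are positive. -/
noncomputable def jacobiK (n : ℕ) (x a b : ℂ) : ℂ :=
  1 / (n.factorial : ℂ) * ∑ m ∈ Finset.range (n + 1),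
    (n.choose m : ℂ) * rising (a + b + n - 1) m * rising (b + m) (n - m) * (x - 1) ^ m

/-- The function `x ↦ ₂F₁(a, b; c; x) K_j(x|f,d) f(x|f,d)`, where `f(x|f,d)` is the density of the
beta distribution with parameters `f`, `d`. -/
noncomputable def hypJacobiBeta (a b c : ℂ) (j : ℕ) (f d : ℝ) (x : ℝ) : ℂ :=
  ₂F₁ a b c (x : ℂ) * jacobiK j x f d * (betaPDFReal f d x : ℂ)

/-- `x` is not one of the poles `0, -1, -2, …` of the Gamma function. -/
def NotNonposInt (x : ℂ) : Prop := ∀ k : ℕ, x ≠ -(k : ℂ)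

/-! ### Rising factorials -/

open Filter Topology Asymptotics

/-! Gauss's theorem and the two Gamma-quotient identities come from one mechanism. Raising `c` (or
`e = c + d`) by one gives a first-order recurrence, proved on partial sums by telescoping, with a
boundary term that tends to zero. After `n` steps the sum `S 0` is tied to `S n` by products of
rising factorials. As `n → ∞` all terms of index at least one die off under a summable majorant, so
`S n → 1`, and Euler's limit turns the products into Gamma functions (`mul_Gamma_inv_eq_of_rising`).

The pairs of `₄F₃` and `₃F₂` series are treated as single very-well-poised series. With `s = e - 1`
one has `(s + 2k) (s + 1)^(k-1) = (s)^(k) + 2k (s + 1)^(k-1)`; the second summand cancels a factor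
of `k!` and produces the series with shifted parameters. The series at `-1` needs two extra
arguments: it may converge only conditionally, and when it terminates only because `e` is a
non-positive integer, the shift to `e + n` is unavailable and a finite induction from `e = 0`
replaces the limit.

For the integrals, `₂F₁` is expanded and integrated term by term. By Chu–Vandermonde the moment of
`x ^ k` against the Jacobi polynomial contains `(k + 1 - j)^(j)`. It vanishes for `k < j`, which is
orthogonality, and reindexing the rest gives the `₃F₂`. If the first beta parameter equals `c`, a
pair of parameters cancels and Gauss's theorem applies.

The last formula combines truncated Gauss sums with parameters lowered by `m + j`. Chu–Vandermonde
collapses the alternating sum over `j` of the reciprocal factorials into one quotient that vanishes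
for `k < n`; reindexing again leaves the `₃F₂`. -/

@[simp] theorem rising_zero (x : ℂ) : rising x 0 = 1 := by simp [rising]

theorem rising_succ (x : ℂ) (n : ℕ) : rising x (n + 1) = rising x n * (x + n) := by
  simp [rising, ascPochhammer_succ_eval]

theorem rising_add (x : ℂ) (m n : ℕ) : rising x (m + n) = rising x m * rising (x + m) n := by
  induction n with
  | zero => simp
  | succ n ih => rw [← add_assoc, rising_succ, ih, rising_succ]; push_cast; ring

theorem rising_succ_left (x : ℂ) (n : ℕ) : rising x (n + 1) = x * rising (x + 1) n := by
  rw [add_comm, rising_add]; simp [rising_succ]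

theorem rising_eq_prod (x : ℂ) (n : ℕ) : rising x n = ∏ i ∈ Finset.range n, (x + i) := by
  induction n with
  | zero => simp
  | succ n ih => rw [rising_succ, ih, Finset.prod_range_succ]

theorem rising_ne_zero {x : ℂ} (hx : NotNonposInt x) (n : ℕ) : rising x n ≠ 0 := by
  rw [rising_eq_prod, Finset.prod_ne_zero_iff]
  intro i _ h
  exact hx i (eq_neg_of_add_eq_zero_left h)

theorem rising_neg_natCast (k n : ℕ) (h : k < n) : rising (-(k : ℂ)) n = 0 := by
  rw [rising_eq_prod, Finset.prod_eq_zero_iff]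
  exact ⟨k, by simpa using h, by simp⟩

theorem rising_natCast_add_one (i j : ℕ) :
    rising (i + 1) j * i.factorial = (i + j).factorial := by
  induction j with
  | zero => simp
  | succ j ih =>
    rw [rising_succ, ← add_assoc, Nat.factorial_succ]; push_cast; rw [← ih]; ring

theorem NotNonposInt.add_natCast {x : ℂ} (hx : NotNonposInt x) (n : ℕ) :
    NotNonposInt (x + n) := by
  intro k h
  refine hx (k + n) ?_
  push_cast
  linear_combination h

theorem NotNonposInt.add_one {x : ℂ} (hx : NotNonposInt x) : NotNonposInt (x + 1) := by
  simpa using hx.add_natCast 1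

theorem NotNonposInt.ne_zero {x : ℂ} (hx : NotNonposInt x) : x ≠ 0 := by
  simpa using hx 0

theorem NotNonposInt.Gamma_ne_zero {x : ℂ} (hx : NotNonposInt x) : Complex.Gamma x ≠ 0 :=
  Complex.Gamma_ne_zero hx

theorem notNonposInt_of_re_pos {x : ℂ} (hx : 0 < x.re) : NotNonposInt x := by
  intro k h
  rw [h] at hx
  simp only [Complex.neg_re, Complex.natCast_re] at hx
  linarith [k.cast_nonneg (α := ℝ)]

/-! ### Growth of rising factorials and of hypergeometric terms -/

theorem tendsto_natCast_div_add (z : ℂ) :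
    Tendsto (fun n : ℕ => (n : ℂ) / (n + z)) atTop (𝓝 1) := by
  have h : Tendsto (fun n : ℕ => (1 + z / (n : ℂ))⁻¹) atTop (𝓝 (1 + 0)⁻¹) :=
    (tendsto_const_nhds.add (tendsto_const_div_atTop_nhds_zero_nat z)).inv₀ (by simp)
  simp only [add_zero, inv_one] at h
  refine h.congr' ?_
  filter_upwards [eventually_ne_atTop 0] with n hn
  have hn : (n : ℂ) ≠ 0 := by exact_mod_cast hn
  rw [show (1 : ℂ) + z / n = (n + z) / n by field_simp, inv_div]

/-- Euler's limit formula for the reciprocal of the Gamma function. -/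
theorem tendsto_rising_div (z : ℂ) :
    Tendsto (fun n : ℕ => rising z n / ((n : ℂ) ^ (z - 1) * n.factorial)) atTop
      (𝓝 (Complex.Gamma z)⁻¹) := by
  by_cases hz : NotNonposInt z
  · have h := ((Complex.GammaSeq_tendsto_Gamma z).inv₀ hz.Gamma_ne_zero).mul
      (tendsto_natCast_div_add z)
    rw [mul_one] at h
    refine h.congr' ?_
    filter_upwards [eventually_ne_atTop 0] with n hn
    have hn : (n : ℂ) ≠ 0 := by exact_mod_cast hn
    have h1 : z + n ≠ 0 := fun h => hz n (eq_neg_of_add_eq_zero_left h)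
    rw [Complex.GammaSeq, ← rising_eq_prod, rising_succ, inv_div, Complex.cpow_sub _ _ hn,
      Complex.cpow_one, add_comm (n : ℂ) z]
    have h2 : (n : ℂ) ^ z ≠ 0 := by simp [Complex.cpow_eq_zero_iff, hn]
    field_simp
  -- At a pole `Complex.Gamma` has the value `0`, hence so has its inverse, in agreement with the
  -- convention `1/Γ = 0`; the rising factorials vanish from some index on.
  · simp only [NotNonposInt, not_forall, not_not] at hz
    obtain ⟨k, rfl⟩ := hz
    rw [Complex.Gamma_neg_nat_eq_zero, inv_zero]
    refine tendsto_const_nhds.congr' ?_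
    filter_upwards [eventually_gt_atTop k] with n hn
    rw [rising_neg_natCast k n hn, zero_div]

theorem isBigO_natCast_cpow (z : ℂ) :
    (fun n : ℕ => (n : ℂ) ^ z * (n.factorial : ℂ)) =Θ[atTop]
      fun n : ℕ => (n : ℝ) ^ z.re * (n.factorial : ℝ) := by
  refine IsTheta.of_norm_eventuallyEq ?_
  filter_upwards [eventually_gt_atTop 0] with n hn
  simp [Complex.norm_natCast_cpow_of_pos hn]

theorem rising_isBigO (z : ℂ) :
    (fun n => rising z n) =O[atTop] fun n : ℕ => (n : ℝ) ^ (z.re - 1) * (n.factorial : ℝ) := by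
  have h := ((tendsto_rising_div z).isBigO_one ℝ).mul (isBigO_natCast_cpow (z - 1)).1
  simp only [one_mul, Complex.sub_re, Complex.one_re] at h
  refine h.congr' ?_ EventuallyEq.rfl
  filter_upwards [eventually_ne_atTop 0] with n hn
  have hn : (n : ℂ) ≠ 0 := by exact_mod_cast hn
  refine div_mul_cancel₀ _ (mul_ne_zero ?_ (by exact_mod_cast n.factorial_ne_zero))
  simp [Complex.cpow_eq_zero_iff, hn]

theorem rising_inv_isBigO {z : ℂ} (hz : NotNonposInt z) :
    (fun n => (rising z n)⁻¹) =O[atTop]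
      fun n : ℕ => ((n : ℝ) ^ (z.re - 1) * (n.factorial : ℝ))⁻¹ := by
  have h := (((tendsto_rising_div z).inv₀
    (inv_ne_zero hz.Gamma_ne_zero)).isBigO_one ℝ).mul (isBigO_natCast_cpow (z - 1)).inv.1
  simp only [one_mul, Complex.sub_re, Complex.one_re] at h
  refine h.congr' ?_ EventuallyEq.rfl
  filter_upwards [eventually_ne_atTop 0] with n hn
  have hn : (n : ℂ) ≠ 0 := by exact_mod_cast hn
  have h1 : (n : ℂ) ^ (z - 1) * n.factorial ≠ 0 := by
    refine mul_ne_zero ?_ (by exact_mod_cast n.factorial_ne_zero)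
    simp [Complex.cpow_eq_zero_iff, hn]
  rw [← mul_inv, div_mul_cancel₀ _ h1]

theorem prod_rising_isBigO (as : List ℂ) :
    (fun n => (as.map fun a => rising a n).prod) =O[atTop]
      fun n : ℕ => (n : ℝ) ^ (as.sum.re - as.length) * (n.factorial : ℝ) ^ as.length := by
  induction as with
  | nil => exact IsBigO.of_bound 1 (Eventually.of_forall fun n => by simp)
  | cons a as ih =>
    simp only [List.map_cons, List.prod_cons, List.sum_cons, List.length_cons]
    refine ((rising_isBigO a).mul ih).congr' EventuallyEq.rfl ?_
    filter_upwards [eventually_gt_atTop 0] with n hn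
    have hn : (0 : ℝ) < n := by exact_mod_cast hn
    rw [show (a + as.sum).re - ((as.length + 1 : ℕ) : ℝ)
      = (a.re - 1) + (as.sum.re - as.length) by push_cast; rw [Complex.add_re]; ring,
      Real.rpow_add hn]
    ring

theorem prod_rising_inv_isBigO {bs : List ℂ} (hbs : ∀ b ∈ bs, NotNonposInt b) :
    (fun n => (bs.map fun b => rising b n).prod⁻¹) =O[atTop]
      fun n : ℕ => ((n : ℝ) ^ (bs.sum.re - bs.length) * (n.factorial : ℝ) ^ bs.length)⁻¹ := by
  induction bs with
  | nil => exact IsBigO.of_bound 1 (Eventually.of_forall fun n => by simp)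
  | cons b bs ih =>
    simp only [List.map_cons, List.prod_cons, List.sum_cons, List.length_cons, mul_inv]
    have h1 := ih fun b hb => hbs b (List.mem_cons_of_mem _ hb)
    have h2 := rising_inv_isBigO (hbs b List.mem_cons_self)
    refine (h2.mul h1).congr' EventuallyEq.rfl ?_
    filter_upwards [eventually_gt_atTop 0] with n hn
    have hn : (0 : ℝ) < n := by exact_mod_cast hn
    rw [show (b + bs.sum).re - ((bs.length + 1 : ℕ) : ℝ)
      = (b.re - 1) + (bs.sum.re - bs.length) by push_cast; rw [Complex.add_re]; ring,
      Real.rpow_add hn]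
    simp only [mul_inv, pow_succ]
    ring

/-- Each rising factorial `(z)^(n)` grows like `n ^ (z - 1) * n!`. With one more upper than lower
parameter, the `n!` of the series balances the factorials, and the exponents `-1` leave a single
`-1`. -/
theorem hypTerm_isBigO {as bs : List ℂ} (hl : as.length = bs.length + 1)
    (hbs : ∀ b ∈ bs, NotNonposInt b) {x : ℂ} (hx : ‖x‖ ≤ 1) :
    hypTerm as bs x =O[atTop] fun n : ℕ => (n : ℝ) ^ (as.sum.re - bs.sum.re - 1) := by
  have hxo : (fun n : ℕ => x ^ n) =O[atTop] fun _ : ℕ => (1 : ℝ) := by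
    refine IsBigO.of_bound 1 (Eventually.of_forall fun n => ?_)
    simpa using pow_le_one₀ (norm_nonneg _) hx
  have hf : (fun n : ℕ => ((n.factorial : ℂ))⁻¹) =O[atTop]
      fun n : ℕ => ((n.factorial : ℝ))⁻¹ :=
    IsBigO.of_bound 1 (Eventually.of_forall fun n => by simp)
  have h := ((prod_rising_isBigO as).mul (prod_rising_inv_isBigO hbs)).mul (hxo.mul hf)
  refine h.congr' (Eventually.of_forall fun n => by simp [hypTerm, div_eq_mul_inv]) ?_
  filter_upwards [eventually_gt_atTop 0] with n hn
  have hn : (0 : ℝ) < n := by exact_mod_cast hn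
  have hf : (n.factorial : ℝ) ≠ 0 := by exact_mod_cast n.factorial_ne_zero
  rw [show as.sum.re - bs.sum.re - 1 = (as.sum.re - as.length) - (bs.sum.re - bs.length) by
    rw [hl]; push_cast; ring, Real.rpow_sub hn (as.sum.re - as.length), hl]
  have := (Real.rpow_pos_of_pos hn (bs.sum.re - bs.length)).ne'
  field_simp
  ring

theorem hypTerm_summable {as bs : List ℂ} (hl : as.length = bs.length + 1)
    (hbs : ∀ b ∈ bs, NotNonposInt b) {x : ℂ} (hx : ‖x‖ ≤ 1) (h : as.sum.re < bs.sum.re) :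
    Summable (hypTerm as bs x) :=
  summable_of_isBigO_nat (Real.summable_nat_rpow.2 (by linarith)) (hypTerm_isBigO hl hbs hx)

/-! ### Limits of partial sums and of iterated recurrences -/

theorem hasSum_conditional_iff {f : ℕ → ℂ} {s : ℂ} :
    HasSum f s (SummationFilter.conditional ℕ) ↔
      Tendsto (fun N => ∑ k ∈ Finset.range N, f k) atTop (𝓝 s) := by
  simp [HasSum, Function.comp_def]

theorem hyp_eq_of_hasSum {as bs : List ℂ} {x s : ℂ}
    (h : HasSum (hypTerm as bs x) s (SummationFilter.conditional ℕ)) : hyp as bs x = s :=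
  h.tsum_eq

theorem HasSum.conditional {f : ℕ → ℂ} {s : ℂ} (h : HasSum f s) :
    HasSum f s (SummationFilter.conditional ℕ) :=
  hasSum_conditional_iff.2 h.tendsto_sum_nat

theorem hypConverges_of_summable {as bs : List ℂ} {x : ℂ} (h : Summable (hypTerm as bs x)) :
    HypConverges as bs x :=
  ⟨_, h.hasSum.conditional⟩

theorem hyp_eq_tsum {as bs : List ℂ} {x : ℂ} (h : Summable (hypTerm as bs x)) :
    hyp as bs x = ∑' k, hypTerm as bs x k :=
  hyp_eq_of_hasSum h.hasSum.conditional

/-- A connection formula `S 0 * ∏ (p i)^(n) = ∏ (q i)^(n) * S n` with `S n → 1` evaluates `S 0`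
as a quotient of Gamma functions. -/
theorem mul_Gamma_inv_eq_of_rising {S₀ : ℂ} {S : ℕ → ℂ} (hS : Tendsto S atTop (𝓝 1))
    {p₁ p₂ p₃ p₄ q₁ q₂ q₃ q₄ : ℂ} (hpq : p₁ + p₂ + p₃ + p₄ = q₁ + q₂ + q₃ + q₄)
    (h : ∀ n, S₀ * (rising p₁ n * rising p₂ n * rising p₃ n * rising p₄ n) =
      rising q₁ n * rising q₂ n * rising q₃ n * rising q₄ n * S n) :
    S₀ * ((Complex.Gamma p₁)⁻¹ * (Complex.Gamma p₂)⁻¹ * (Complex.Gamma p₃)⁻¹ *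
        (Complex.Gamma p₄)⁻¹) =
      (Complex.Gamma q₁)⁻¹ * (Complex.Gamma q₂)⁻¹ * (Complex.Gamma q₃)⁻¹ *
        (Complex.Gamma q₄)⁻¹ := by
  have t := tendsto_rising_div
  have hl := ((((t p₁).mul (t p₂)).mul (t p₃)).mul (t p₄)).const_mul S₀
  have hr := ((((t q₁).mul (t q₂)).mul (t q₃)).mul (t q₄)).mul hS
  rw [mul_one] at hr
  refine tendsto_nhds_unique hl (hr.congr' ?_)
  filter_upwards [eventually_ne_atTop 0] with n hn
  have hn : (n : ℂ) ≠ 0 := by exact_mod_cast hn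
  have e : ∀ x y : ℂ, (n : ℂ) ^ x * (n : ℂ) ^ y = (n : ℂ) ^ (x + y) :=
    fun x y => (Complex.cpow_add _ _ hn).symm
  -- The balance `hpq` makes the powers of `n` in Euler's limits agree on both sides. Each side has
  -- four factors so that the factorials agree too; shorter identities are padded with the parameter
  -- `1`.
  have e4 : (n : ℂ) ^ (p₁ - 1) * (n : ℂ) ^ (p₂ - 1) * (n : ℂ) ^ (p₃ - 1) * (n : ℂ) ^ (p₄ - 1) =
      (n : ℂ) ^ (q₁ - 1) * (n : ℂ) ^ (q₂ - 1) * (n : ℂ) ^ (q₃ - 1) * (n : ℂ) ^ (q₄ - 1) := by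
    simp only [e]
    congr 1
    linear_combination hpq
  simp only [div_mul_div_comm]
  rw [div_mul_eq_mul_div, ← h n, ← mul_div_assoc]
  congr 1
  linear_combination -(n.factorial : ℂ) ^ 4 * e4

/-- If the terms of index `0` are `1` and the other terms are at most `ε n * D k` with `D`
summable and `ε n → 0`, then the sums tend to `1`. -/
theorem tendsto_tsum_one_of_norm_le {F : ℕ → ℕ → ℂ} {D : ℕ → ℝ} {ε : ℕ → ℝ} (hD : Summable D)
    (hε : Tendsto ε atTop (𝓝 0)) (h0 : ∀ n, F n 0 = 1)
    (h : ∀ᶠ n in atTop, ∀ k, ‖F n (k + 1)‖ ≤ ε n * D k) :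
    Tendsto (fun n => ∑' k, F n k) atTop (𝓝 1) := by
  rw [tendsto_iff_norm_sub_tendsto_zero]
  have hb : Tendsto (fun n => ε n * ∑' k, D k) atTop (𝓝 0) := by
    simpa using hε.mul_const (∑' k, D k)
  refine squeeze_zero' (Eventually.of_forall fun n => norm_nonneg _) ?_ hb
  filter_upwards [h] with n hn
  have hs : Summable fun k => F n (k + 1) := Summable.of_norm_bounded (hD.mul_left _) hn
  have hs' : Summable (F n) := (summable_nat_add_iff 1).1 hs
  rw [hs'.tsum_eq_zero_add, h0, add_sub_cancel_left, ← tsum_mul_left]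
  exact tsum_of_norm_bounded (hD.mul_left _).hasSum hn

theorem re_add_natCast_le_norm (z : ℂ) (i : ℕ) : z.re + i ≤ ‖z + i‖ := by
  simpa using Complex.re_le_norm (z + i)

theorem norm_ofReal_add_natCast {r : ℝ} (hr : 0 < r) (i : ℕ) : ‖(r : ℂ) + i‖ = r + i := by
  rw [← Complex.ofReal_natCast, ← Complex.ofReal_add, Complex.norm_of_nonneg (by positivity)]

theorem notNonposInt_ofReal {r : ℝ} (hr : 0 < r) : NotNonposInt (r : ℂ) :=
  notNonposInt_of_re_pos (by simpa)

theorem norm_rising_le_of_le_re {r : ℝ} (hr : 0 < r) {z : ℂ} (h : r ≤ z.re) (n : ℕ) :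
    ‖rising r n‖ ≤ ‖rising z n‖ := by
  simp only [rising_eq_prod, norm_prod]
  refine Finset.prod_le_prod (fun _ _ => norm_nonneg _) fun i _ => ?_
  rw [norm_ofReal_add_natCast hr]
  linarith [re_add_natCast_le_norm z i]

/-- Splitting off the first factor `z` before comparing the others retains a gain of `r / ‖z‖` over
the plain comparison. This gain is the `ε n` that sends the tails to zero. -/
theorem norm_mul_norm_rising_succ_le {r : ℝ} (hr : 0 < r) {z : ℂ} (h : r ≤ z.re) (n : ℕ) :
    ‖z‖ * ‖rising r (n + 1)‖ ≤ r * ‖rising z (n + 1)‖ := by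
  have h1 := norm_rising_le_of_le_re (r := r + 1) (by linarith) (z := z + 1) (by simpa) n
  rw [rising_succ_left, rising_succ_left z, norm_mul, norm_mul, Complex.norm_of_nonneg hr.le]
  push_cast at h1
  calc _ = ‖z‖ * r * ‖rising (r + 1) n‖ := by ring
    _ ≤ ‖z‖ * r * ‖rising (z + 1) n‖ := by gcongr
    _ = _ := by ring

/-- Factor by factor, `‖e + i‖ / ‖e - a + i‖ ≤ 1 + ‖a‖ / (r + i)`. The bound on the quotient of
rising factorials is thus uniform in `e`, as a majorant for all large shifts requires. -/
theorem norm_rising_mul_le {r : ℝ} (hr : 0 < r) {e a : ℂ} (h : r ≤ (e - a).re) (n : ℕ) :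
    ‖rising e n‖ * ‖rising r n‖ ≤ ‖rising (e - a) n‖ * ‖rising ((r + ‖a‖ : ℝ) : ℂ) n‖ := by
  simp only [rising_eq_prod, ← norm_mul, ← Finset.prod_mul_distrib]
  rw [norm_prod, norm_prod]
  refine Finset.prod_le_prod (fun _ _ => norm_nonneg _) fun i _ => ?_
  rw [norm_mul, norm_mul, norm_ofReal_add_natCast hr, norm_ofReal_add_natCast (by positivity)]
  have h1 : ‖e + i‖ ≤ ‖e - a + i‖ + ‖a‖ := by
    simpa [sub_add_eq_add_sub] using norm_add_le (e - a + i) a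
  have h2 : r + i ≤ ‖e - a + i‖ := by linarith [re_add_natCast_le_norm (e - a) i]
  have h3 : (0 : ℝ) ≤ r + i := by positivity
  nlinarith [mul_le_mul_of_nonneg_right h1 h3, mul_le_mul_of_nonneg_left h2 (norm_nonneg a)]

theorem tendsto_norm_add_natCast (z : ℂ) : Tendsto (fun n : ℕ => ‖z + n‖) atTop atTop := by
  refine tendsto_atTop_mono (re_add_natCast_le_norm z) ?_
  exact tendsto_atTop_add_const_left _ _ tendsto_natCast_atTop_atTop

theorem eventually_le_re_add_natCast (r : ℝ) (z : ℂ) : ∀ᶠ n : ℕ in atTop, r ≤ (z + n).re := by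
  have h := tendsto_atTop_add_const_left atTop z.re (tendsto_natCast_atTop_atTop (R := ℝ))
  filter_upwards [h.eventually_ge_atTop r] with n hn
  simpa using hn

theorem tendsto_const_div_norm_add_natCast (C : ℝ) (z : ℂ) :
    Tendsto (fun n : ℕ => C / ‖z + n‖) atTop (𝓝 0) :=
  (tendsto_norm_add_natCast z).const_div_atTop C

/-- A telescoping relation in the limit. -/
theorem mul_eq_mul_of_telescope {u v g : ℕ → ℂ} {A B s t : ℂ}
    (hu : Tendsto (fun N => ∑ k ∈ Finset.range N, u k) atTop (𝓝 s))
    (hv : Tendsto (fun N => ∑ k ∈ Finset.range N, v k) atTop (𝓝 t))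
    (hg : Tendsto g atTop (𝓝 0))
    (h : ∀ N, A * ∑ k ∈ Finset.range (N + 1), u k =
      B * ∑ k ∈ Finset.range (N + 1), v k + g N) : A * s = B * t := by
  have h1 := ((tendsto_add_atTop_iff_nat 1).2 hu).const_mul A
  have h2 := (((tendsto_add_atTop_iff_nat 1).2 hv).const_mul B).add hg
  rw [add_zero] at h2
  exact tendsto_nhds_unique h1 (h2.congr fun N => (h N).symm)

/-! ### Gauss's theorem -/

theorem gauss_summable {a b c : ℂ} (h : 0 < (c - a - b).re) (hc : NotNonposInt c) :
    Summable (hypTerm [a, b] [c] 1) := by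
  refine hypTerm_summable rfl (by simpa using hc) (by simp) ?_
  simp only [Complex.sub_re] at h
  simp
  linarith

theorem tendsto_zero_of_isBigO_rpow {f : ℕ → ℂ} {p : ℝ} (hf : f =O[atTop] fun n : ℕ => (n : ℝ) ^ p)
    (hp : p < 0) : Tendsto f atTop (𝓝 0) := by
  refine hf.trans_tendsto ?_
  have := (tendsto_rpow_neg_atTop (y := -p) (by linarith)).comp
    (tendsto_natCast_atTop_atTop (R := ℝ))
  simpa [Function.comp_def] using this

theorem natCast_mul_hypTerm_tendsto {as bs : List ℂ} (hl : as.length = bs.length + 1)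
    (hbs : ∀ b ∈ bs, NotNonposInt b) {x : ℂ} (hx : ‖x‖ ≤ 1) (h : as.sum.re < bs.sum.re) :
    Tendsto (fun n : ℕ => (n : ℂ) * hypTerm as bs x n) atTop (𝓝 0) := by
  have h1 : (fun n : ℕ => (n : ℂ)) =O[atTop] fun n : ℕ => (n : ℝ) :=
    IsBigO.of_bound 1 (Eventually.of_forall fun n => by simp)
  have h2 := h1.mul (hypTerm_isBigO hl hbs hx)
  refine tendsto_zero_of_isBigO_rpow (h2.congr' EventuallyEq.rfl ?_)
    (p := as.sum.re - bs.sum.re) (by linarith)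
  filter_upwards [eventually_gt_atTop 0] with n hn
  have hn : (0 : ℝ) < n := by exact_mod_cast hn
  rw [Real.rpow_sub hn _ 1, Real.rpow_one]
  field_simp

/-- The contiguous relation between `c` and `c + 1`, at the level of partial sums. The boundary term
is the index times a term of the series, which tends to zero because `Re (c - a - b) > 0`. -/
theorem gauss_telescope (a b : ℂ) {c : ℂ} (hc : NotNonposInt c) (N : ℕ) :
    c * (c - a - b) * ∑ k ∈ Finset.range (N + 1), hypTerm [a, b] [c] 1 k =
      (c - a) * (c - b) * ∑ k ∈ Finset.range (N + 1), hypTerm [a, b] [c + 1] 1 k +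
        -(c * (N + 1) * hypTerm [a, b] [c] 1 (N + 1)) := by
  induction N with
  | zero =>
    have := hc.ne_zero
    simp [hypTerm, rising_succ]
    field_simp
    ring
  | succ N ih =>
    rw [Finset.sum_range_succ, mul_add, ih, Finset.sum_range_succ _ (N + 1)]
    have h0 := hc.ne_zero
    have h1 := rising_ne_zero hc (N + 1)
    have h2 : c + (N + 1 : ℕ) ≠ 0 := (hc.add_natCast _).ne_zero
    have h3 : rising (c + 1) (N + 1) = rising c (N + 1) * (c + (N + 1 : ℕ)) / c := by
      rw [eq_div_iff h0, ← rising_succ, rising_succ_left c]; ring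
    have h4 : ((N + 1).factorial : ℂ) ≠ 0 := by exact_mod_cast (N + 1).factorial_ne_zero
    simp only [hypTerm, List.map_cons, List.map_nil, List.prod_cons, List.prod_nil, one_pow,
      mul_one, h3, rising_succ _ (N + 1), Nat.factorial_succ (N + 1)]
    have h5 : ((N + 1 : ℕ) : ℂ) + 1 ≠ 0 := by exact_mod_cast (N + 1).succ_ne_zero
    push_cast at *
    field_simp
    ring

theorem gauss_recurrence {a b c : ℂ} (h : 0 < (c - a - b).re) (hc : NotNonposInt c) :
    c * (c - a - b) * hyp [a, b] [c] 1 = (c - a) * (c - b) * hyp [a, b] [c + 1] 1 := by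
  have hs := gauss_summable h hc
  have hs' : Summable (hypTerm [a, b] [c + 1] 1) := by
    refine gauss_summable ?_ hc.add_one
    simp at h ⊢
    linarith
  rw [hyp_eq_tsum hs, hyp_eq_tsum hs']
  refine mul_eq_mul_of_telescope hs.hasSum.tendsto_sum_nat hs'.hasSum.tendsto_sum_nat ?_
    (gauss_telescope a b hc)
  have h3 := natCast_mul_hypTerm_tendsto (as := [a, b]) (bs := [c]) (x := 1) rfl
    (by simpa using hc) (by simp) (by simp at h ⊢; linarith)
  have h4 := ((tendsto_add_atTop_iff_nat 1).2 h3).const_mul (-c)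
  rw [mul_zero] at h4
  refine h4.congr fun n => ?_
  push_cast
  ring

theorem gauss_rising {a b c : ℂ} (h : 0 < (c - a - b).re) (hc : NotNonposInt c) (n : ℕ) :
    hyp [a, b] [c] 1 * (rising c n * rising (c - a - b) n) =
      rising (c - a) n * rising (c - b) n * hyp [a, b] [c + n] 1 := by
  induction n with
  | zero => simp
  | succ n ih =>
    have h1 := gauss_recurrence (a := a) (b := b) (c := c + n)
      (by simp at h ⊢; linarith [n.cast_nonneg (α := ℝ)]) (hc.add_natCast n)
    simp only [rising_succ]
    push_cast
    rw [← add_assoc]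
    linear_combination (c + n) * (c - a - b + n) * ih + rising (c - a) n * rising (c - b) n * h1

theorem gauss_tendsto {a b c : ℂ} (h : 0 < (c - a - b).re) (hc : NotNonposInt c) :
    Tendsto (fun n : ℕ => hyp [a, b] [c + n] 1) atTop (𝓝 1) := by
  -- Chosen so that the majorant `₂F₁(a, b; r; 1)` converges absolutely.
  set r : ℝ := 1 + ‖a‖ + ‖b‖ with hr
  have hr0 : 0 < r := by positivity
  have hD : Summable (hypTerm [a, b] [(r : ℂ)] 1) := by
    refine gauss_summable ?_ (notNonposInt_ofReal hr0)
    simp [hr]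
    linarith [Complex.re_le_norm a, Complex.re_le_norm b]
  have key := tendsto_tsum_one_of_norm_le (F := fun n : ℕ => hypTerm [a, b] [c + n] 1)
    (D := fun k => ‖hypTerm [a, b] [(r : ℂ)] 1 (k + 1)‖) (ε := fun n : ℕ => r / ‖c + n‖)
    ((summable_nat_add_iff 1).2 hD.norm) (tendsto_const_div_norm_add_natCast r c)
    (fun n => by simp [hypTerm]) ?_
  · refine key.congr fun n => (hyp_eq_tsum (gauss_summable ?_ (hc.add_natCast n))).symm
    simp at h ⊢
    linarith [n.cast_nonneg (α := ℝ)]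
  · filter_upwards [eventually_le_re_add_natCast r c] with n hn k
    have h1 := norm_mul_norm_rising_succ_le hr0 hn k
    have h2 : 0 < ‖rising r (k + 1)‖ :=
      norm_pos_iff.2 (rising_ne_zero (notNonposInt_ofReal hr0) _)
    have h3 : 0 < ‖c + n‖ := by linarith [Complex.re_le_norm (c + n)]
    have h4 : 0 < ‖rising (c + n) (k + 1)‖ :=
      h2.trans_le (norm_rising_le_of_le_re hr0 hn _)
    simp only [hypTerm, List.map_cons, List.map_nil, List.prod_cons, List.prod_nil, one_pow,
      mul_one, norm_mul, norm_div, norm_one]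
    have h5 : ‖rising (c + n) (k + 1)‖⁻¹ ≤ r / ‖c + n‖ * ‖rising r (k + 1)‖⁻¹ := by
      rw [← div_eq_mul_inv, div_div, inv_eq_one_div, div_le_div_iff₀ h4 (by positivity)]
      linarith
    rw [div_eq_mul_inv _ ‖rising (c + n) (k + 1)‖, div_eq_mul_inv _ ‖rising r (k + 1)‖]
    calc _ ≤ _ := mul_le_mul_of_nonneg_right (mul_le_mul_of_nonneg_left h5 (by positivity))
          (by positivity)
      _ = _ := by ring

/-- **Gauss's summation theorem**. -/
theorem gauss_sum {a b c : ℂ} (h : 0 < (c - a - b).re) (hc : NotNonposInt c) :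
    hyp [a, b] [c] 1 = Complex.Gamma c * Complex.Gamma (c - a - b) /
      (Complex.Gamma (c - a) * Complex.Gamma (c - b)) := by
  have h1 := mul_Gamma_inv_eq_of_rising (S₀ := hyp [a, b] [c] 1) (gauss_tendsto h hc)
    (p₁ := c) (p₂ := c - a - b) (p₃ := 1) (p₄ := 1) (q₁ := c - a) (q₂ := c - b) (q₃ := 1)
    (q₄ := 1) (by ring) fun n => by
      linear_combination rising 1 n * rising 1 n * gauss_rising h hc n
  simp only [Complex.Gamma_one, inv_one, mul_one] at h1
  have h2 := hc.Gamma_ne_zero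
  have h3 := (notNonposInt_of_re_pos h).Gamma_ne_zero
  rw [div_eq_mul_inv, mul_inv, ← h1]
  field_simp

/-! ### Very-well-poised series: majorants, telescoping and splitting -/

/-- `(s + 2k) (s + 1)^(k - 1)` with `s = e - 1`, and `1` for `k = 0`. -/
noncomputable def wpFactor (e : ℂ) : ℕ → ℂ
  | 0 => 1
  | k + 1 => (e + 1 + 2 * k) * rising e k

/-- `wpFactor e k / ((e - a)^(k) (e - b)^(k))`. -/
noncomputable def wpRatio (a b e : ℂ) (k : ℕ) : ℂ :=
  wpFactor e k / (rising (e - a) k * rising (e - b) k)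

/-- The terms of the very-well-poised `₅F₄` series at `1`. -/
noncomputable def vwpFive (a b c d : ℂ) (k : ℕ) : ℂ :=
  rising a k * rising b k * rising d k / (rising c k * (k.factorial : ℂ)) * wpRatio a b (c + d) k

/-- The terms of the very-well-poised `₄F₃` series at `-1`. -/
noncomputable def vwpFour (a b e : ℂ) (k : ℕ) : ℂ :=
  (-1) ^ k * (rising a k * rising b k / (k.factorial : ℂ)) * wpRatio a b e k

/-- For `Re e ≥ 1` one has `‖e + 1 + 2k‖ ≤ 2 ‖e + k‖`, so `wpFactor` is at most twice a rising
factorial of `e`. Its quotient by that of `e - a` is bounded uniformly in `e`, while that of `e - b`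
supplies the decaying factor `1 / ‖e - b‖`. -/
theorem norm_wpRatio_succ_le {r : ℝ} (hr : 0 < r) {a b e : ℂ} (he : 1 ≤ e.re)
    (ha : r ≤ (e - a).re) (hb : r ≤ (e - b).re) (k : ℕ) :
    ‖wpRatio a b e (k + 1)‖ ≤ 2 * r / ‖e - b‖ *
      ‖rising ((r + ‖a‖ : ℝ) : ℂ) (k + 1) / (rising r (k + 1) * rising r (k + 1))‖ := by
  have hb0 : 0 < ‖e - b‖ := by linarith [Complex.re_le_norm (e - b)]
  have hr' : 0 < ‖rising r (k + 1)‖ :=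
    norm_pos_iff.2 (rising_ne_zero (notNonposInt_ofReal hr) _)
  have hA : 0 < ‖rising (e - a) (k + 1)‖ := hr'.trans_le (norm_rising_le_of_le_re hr ha _)
  have hB : 0 < ‖rising (e - b) (k + 1)‖ := hr'.trans_le (norm_rising_le_of_le_re hr hb _)
  have h1 := norm_rising_mul_le hr ha (k + 1)
  have h2 := norm_mul_norm_rising_succ_le hr hb k
  have h3 : ‖wpFactor e (k + 1)‖ ≤ 2 * ‖rising e (k + 1)‖ := by
    rw [wpFactor, rising_succ, norm_mul, norm_mul, mul_comm ‖rising e k‖, ← mul_assoc]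
    gcongr
    have h4 : (k : ℝ) + 1 ≤ ‖e + k‖ := by linarith [re_add_natCast_le_norm e k]
    calc ‖e + 1 + 2 * k‖ = ‖(e + k) + ((k + 1 : ℕ) : ℂ)‖ := by congr 1; push_cast; ring
      _ ≤ ‖e + k‖ + ‖((k + 1 : ℕ) : ℂ)‖ := norm_add_le _ _
      _ ≤ 2 * ‖e + k‖ := by rw [Complex.norm_natCast]; push_cast; linarith
  rw [wpRatio, norm_div, norm_mul, norm_div, norm_mul, div_mul_div_comm,
    div_le_div_iff₀ (by positivity) (by positivity)]
  calc ‖wpFactor e (k + 1)‖ * (‖e - b‖ * (‖rising r (k + 1)‖ * ‖rising r (k + 1)‖))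
      ≤ 2 * ‖rising e (k + 1)‖ * (‖e - b‖ * (‖rising r (k + 1)‖ * ‖rising r (k + 1)‖)) := by
        gcongr
    _ = 2 * (‖rising e (k + 1)‖ * ‖rising r (k + 1)‖) * (‖e - b‖ * ‖rising r (k + 1)‖) := by ring
    _ ≤ 2 * (‖rising (e - a) (k + 1)‖ * ‖rising ((r + ‖a‖ : ℝ) : ℂ) (k + 1)‖) *
        (r * ‖rising (e - b) (k + 1)‖) := by gcongr
    _ = _ := by ring

theorem rising_add_one_eq {c : ℂ} (hc : NotNonposInt c) (k : ℕ) :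
    rising (c + 1) k = rising c k * (c + k) / c := by
  rw [eq_div_iff hc.ne_zero, ← rising_succ, rising_succ_left c]; ring

theorem vwpFive_telescope {a b c d : ℂ} (hc : NotNonposInt c) (hA : NotNonposInt (c + d - a))
    (hB : NotNonposInt (c + d - b)) (N : ℕ) :
    c * (c - a - b) * (c + d - a) * (c + d - b) *
        ∑ k ∈ Finset.range (N + 1), vwpFive a b c d k =
      (c - a) * (c - b) * (c + d) * (c + d - a - b) *
        ∑ k ∈ Finset.range (N + 1), vwpFive a b (c + 1) d k +
      -(c * (c + d - a) * (c + d - b) * (N + (c + d) + (c - a - b)) *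
        (rising a (N + 1) * rising b (N + 1) * rising d (N + 1) * rising (c + d) N /
          (rising c (N + 1) * rising (c + d - a) (N + 1) * rising (c + d - b) (N + 1) *
            N.factorial))) := by
  induction N with
  | zero =>
    have := hc.ne_zero
    have := hA.ne_zero
    have := hB.ne_zero
    simp [vwpFive, wpRatio, wpFactor, rising_succ]
    field_simp
    ring
  | succ N ih =>
    rw [Finset.sum_range_succ, mul_add, ih, Finset.sum_range_succ _ (N + 1), mul_add _ (Finset.sum _ _)]
    -- The partial sums for `c + 1` now cancel, and a rational identity between single terms
    -- remains.
    refine (add_assoc _ _ _).trans (Eq.trans ?_ (add_assoc _ _ _).symm)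
    congr 1
    have h0 := hc.ne_zero
    have h1 := rising_ne_zero hc (N + 1)
    have h2 : c + (N + 1 : ℕ) ≠ 0 := (hc.add_natCast _).ne_zero
    have hA0 := hA.ne_zero
    have hA1 := rising_ne_zero hA (N + 1)
    have hA2 : c + d - a + (N + 1 : ℕ) ≠ 0 := (hA.add_natCast _).ne_zero
    have hB0 := hB.ne_zero
    have hB1 := rising_ne_zero hB (N + 1)
    have hB2 : c + d - b + (N + 1 : ℕ) ≠ 0 := (hB.add_natCast _).ne_zero
    have h4 : ((N).factorial : ℂ) ≠ 0 := by exact_mod_cast (N).factorial_ne_zero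
    have h5 : (N : ℂ) + 1 ≠ 0 := by exact_mod_cast (N).succ_ne_zero
    -- The factor `c + d` is absorbed here rather than divided out, since it may be zero.
    have hE : (c + d) * wpFactor (c + d + 1) (N + 1) =
        (c + d + 2 + 2 * N) * (rising (c + d) N * (c + d + N)) := by
      rw [← rising_succ, rising_succ_left, wpFactor]; ring
    have e1 : (c - a) * (c - b) * (c + d) * (c + d - a - b) * vwpFive a b (c + 1) d (N + 1) =
        (c - a) * (c - b) * (c + d - a - b) *
          (rising a (N + 1) * rising b (N + 1) * rising d (N + 1) /
            (rising c (N + 1) * (c + (N + 1)) / c * ((N + 1) * N.factorial)) *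
          ((c + d + 2 + 2 * N) * (rising (c + d) N * (c + d + N)) /
            ((rising (c + d - a) (N + 1) * (c + d - a + (N + 1)) / (c + d - a)) *
              (rising (c + d - b) (N + 1) * (c + d - b + (N + 1)) / (c + d - b))))) := by
      rw [← hE, vwpFive, wpRatio, show c + 1 + d = c + d + 1 by ring,
        show c + d + 1 - a = c + d - a + 1 by ring, show c + d + 1 - b = c + d - b + 1 by ring,
        rising_add_one_eq hc, rising_add_one_eq hA, rising_add_one_eq hB, Nat.factorial_succ]
      push_cast
      ring
    have e2 : vwpFive a b c d (N + 1) = rising a (N + 1) * rising b (N + 1) * rising d (N + 1) /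
          (rising c (N + 1) * ((N + 1) * N.factorial)) * ((c + d + 1 + 2 * N) * rising (c + d) N /
            (rising (c + d - a) (N + 1) * rising (c + d - b) (N + 1))) := by
      rw [vwpFive, wpRatio, wpFactor, Nat.factorial_succ]
      push_cast
      ring
    rw [e1, e2]
    simp only [rising_succ _ (N + 1), rising_succ (c + d) N, Nat.factorial_succ N]
    push_cast at *
    generalize rising a (N + 1) = xa
    generalize rising b (N + 1) = xb
    generalize rising d (N + 1) = xd
    generalize rising (c + d) N = xe
    generalize rising c (N + 1) = xc at *
    generalize rising (c + d - a) (N + 1) = xA at *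
    generalize rising (c + d - b) (N + 1) = xB at *
    generalize (N.factorial : ℂ) = F at *
    clear ih e1 e2 hE
    field_simp
    ring

theorem vwpFour_telescope {a b e : ℂ} (hA : NotNonposInt (e - a))
    (hB : NotNonposInt (e - b)) (N : ℕ) :
    (e - a) * (e - b) * ∑ k ∈ Finset.range (N + 1), vwpFour a b e k =
      e * (e - a - b) * ∑ k ∈ Finset.range (N + 1), vwpFour a b (e + 1) k +
      ((e - a) * (e - b) * ((-1) ^ N *
        (rising a (N + 1) * rising b (N + 1) * rising e N /
          (rising (e - a) (N + 1) * rising (e - b) (N + 1) * N.factorial)))) := by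
  induction N with
  | zero =>
    have := hA.ne_zero
    have := hB.ne_zero
    simp [vwpFour, wpRatio, wpFactor, rising_succ]
    field_simp
    ring
  | succ N ih =>
    rw [Finset.sum_range_succ, mul_add, ih, Finset.sum_range_succ _ (N + 1), mul_add _ (Finset.sum _ _)]
    refine (add_assoc _ _ _).trans (Eq.trans ?_ (add_assoc _ _ _).symm)
    congr 1
    have hA0 := hA.ne_zero
    have hA1 := rising_ne_zero hA (N + 1)
    have hA2 : e - a + (N + 1 : ℕ) ≠ 0 := (hA.add_natCast _).ne_zero
    have hB0 := hB.ne_zero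
    have hB1 := rising_ne_zero hB (N + 1)
    have hB2 : e - b + (N + 1 : ℕ) ≠ 0 := (hB.add_natCast _).ne_zero
    have h4 : ((N).factorial : ℂ) ≠ 0 := by exact_mod_cast (N).factorial_ne_zero
    have h5 : (N : ℂ) + 1 ≠ 0 := by exact_mod_cast (N).succ_ne_zero
    have hE : e * wpFactor (e + 1) (N + 1) = (e + 2 + 2 * N) * (rising e N * (e + N)) := by
      rw [← rising_succ, rising_succ_left, wpFactor]; ring
    have e1 : e * (e - a - b) * vwpFour a b (e + 1) (N + 1) =
        (e - a - b) * (-((-1) ^ N) * (rising a (N + 1) * rising b (N + 1) /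
            ((N + 1) * N.factorial)) *
          ((e + 2 + 2 * N) * (rising e N * (e + N)) /
            ((rising (e - a) (N + 1) * (e - a + (N + 1)) / (e - a)) *
              (rising (e - b) (N + 1) * (e - b + (N + 1)) / (e - b))))) := by
      rw [← hE, vwpFour, wpRatio,
        show e + 1 - a = e - a + 1 by ring, show e + 1 - b = e - b + 1 by ring,
        rising_add_one_eq hA, rising_add_one_eq hB, Nat.factorial_succ]
      push_cast
      ring
    have e2 : vwpFour a b e (N + 1) = -((-1) ^ N) * (rising a (N + 1) * rising b (N + 1) /
          ((N + 1) * N.factorial)) * ((e + 1 + 2 * N) * rising e N /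
            (rising (e - a) (N + 1) * rising (e - b) (N + 1))) := by
      rw [vwpFour, wpRatio, wpFactor, Nat.factorial_succ]
      push_cast
      ring
    rw [e1, e2]
    simp only [rising_succ _ (N + 1), rising_succ e N, Nat.factorial_succ N, pow_succ (-1 : ℂ) N]
    push_cast at *
    generalize rising a (N + 1) = xa
    generalize rising b (N + 1) = xb
    generalize rising e N = xe
    generalize rising (e - a) (N + 1) = xA at *
    generalize rising (e - b) (N + 1) = xB at *
    generalize (N.factorial : ℂ) = F at *
    generalize (-1 : ℂ) ^ N = σ at *
    clear ih e1 e2 hE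
    field_simp
    ring

/-- For small `n` the series may converge only conditionally, so its value enters as a limit of
partial sums. Once the majorant applies, this limit agrees with the unconditional sum. -/
theorem tendsto_one_of_norm_le {F : ℕ → ℕ → ℂ} {S : ℕ → ℂ} {D : ℕ → ℝ} {ε : ℕ → ℝ}
    (hD : Summable D) (hε : Tendsto ε atTop (𝓝 0)) (h0 : ∀ n, F n 0 = 1)
    (h : ∀ᶠ n in atTop, ∀ k, ‖F n (k + 1)‖ ≤ ε n * D k)
    (hS : ∀ n, Tendsto (fun N => ∑ k ∈ Finset.range N, F n k) atTop (𝓝 (S n))) :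
    Tendsto S atTop (𝓝 1) := by
  refine (tendsto_tsum_one_of_norm_le hD hε h0 h).congr' ?_
  filter_upwards [h] with n hn
  have hs : Summable fun k => F n (k + 1) := Summable.of_norm_bounded (hD.mul_left _) hn
  exact tendsto_nhds_unique ((summable_nat_add_iff 1).1 hs).hasSum.tendsto_sum_nat (hS n)

theorem HypConverges.tendsto {as bs : List ℂ} {x : ℂ} (h : HypConverges as bs x) :
    Tendsto (fun N => ∑ k ∈ Finset.range N, hypTerm as bs x k) atTop (𝓝 (hyp as bs x)) :=
  hasSum_conditional_iff.1 h.hasSum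

/-- Writing `s + 2k` as `s` plus `2k` splits the term of index `k` into the `k`-th term of one
series and the `(k - 1)`-th of the shifted one; hence the second range is shorter by one. -/
theorem vwpFive_partial_sum {a b c d : ℂ} (hc : NotNonposInt c) (hA : NotNonposInt (c + d - a))
    (hB : NotNonposInt (c + d - b)) (N : ℕ) :
    ∑ k ∈ Finset.range (N + 1), vwpFive a b c d k =
      ∑ k ∈ Finset.range (N + 1),
        hypTerm [a, b, d, c + d - 1] [c, c + d - a, c + d - b] 1 k +
      2 * a * b * d / (c * (c + d - a) * (c + d - b)) * ∑ k ∈ Finset.range N,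
        hypTerm [a + 1, b + 1, d + 1, c + d] [c + 1, c + d - a + 1, c + d - b + 1] 1 k := by
  induction N with
  | zero => simp [vwpFive, wpRatio, wpFactor, hypTerm]
  | succ N ih =>
    rw [Finset.sum_range_succ, ih, Finset.sum_range_succ _ (N + 1),
      Finset.sum_range_succ (hypTerm [a + 1, b + 1, d + 1, c + d] _ _) N]
    have h4 : ((N).factorial : ℂ) ≠ 0 := by exact_mod_cast (N).factorial_ne_zero
    have h5 : (N : ℂ) + 1 ≠ 0 := by exact_mod_cast (N).succ_ne_zero
    have h0 := hc.ne_zero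
    have h1 := rising_ne_zero hc.add_one N
    have hA0 := hA.ne_zero
    have hA1 := rising_ne_zero hA.add_one N
    have hB0 := hB.ne_zero
    have hB1 := rising_ne_zero hB.add_one N
    have key : vwpFive a b c d (N + 1) =
        hypTerm [a, b, d, c + d - 1] [c, c + d - a, c + d - b] 1 (N + 1) +
        2 * a * b * d / (c * (c + d - a) * (c + d - b)) *
          hypTerm [a + 1, b + 1, d + 1, c + d] [c + 1, c + d - a + 1, c + d - b + 1] 1 N := by
      simp only [vwpFive, wpRatio, wpFactor, hypTerm, List.map_cons, List.map_nil,
        List.prod_cons, List.prod_nil, one_pow, mul_one, rising_succ_left _ N, Nat.factorial_succ,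
        show c + d - 1 + 1 = c + d by ring]
      push_cast
      field_simp
      ring
    rw [key]
    ring

theorem vwpFour_partial_sum {a b e : ℂ} (hA : NotNonposInt (e - a)) (hB : NotNonposInt (e - b))
    (N : ℕ) :
    ∑ k ∈ Finset.range (N + 1), vwpFour a b e k =
      ∑ k ∈ Finset.range (N + 1), hypTerm [a, b, e - 1] [e - a, e - b] (-1) k -
      2 * a * b / ((e - a) * (e - b)) * ∑ k ∈ Finset.range N,
        hypTerm [a + 1, b + 1, e] [e - a + 1, e - b + 1] (-1) k := by
  induction N with
  | zero => simp [vwpFour, wpRatio, wpFactor, hypTerm]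
  | succ N ih =>
    rw [Finset.sum_range_succ, ih, Finset.sum_range_succ _ (N + 1),
      Finset.sum_range_succ (hypTerm [a + 1, b + 1, e] _ _) N]
    have h4 : ((N).factorial : ℂ) ≠ 0 := by exact_mod_cast (N).factorial_ne_zero
    have h5 : (N : ℂ) + 1 ≠ 0 := by exact_mod_cast (N).succ_ne_zero
    have hA0 := hA.ne_zero
    have hA1 := rising_ne_zero hA.add_one N
    have hB0 := hB.ne_zero
    have hB1 := rising_ne_zero hB.add_one N
    have key : vwpFour a b e (N + 1) =
        hypTerm [a, b, e - 1] [e - a, e - b] (-1) (N + 1) -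
        2 * a * b / ((e - a) * (e - b)) *
          hypTerm [a + 1, b + 1, e] [e - a + 1, e - b + 1] (-1) N := by
      simp only [vwpFour, wpRatio, wpFactor, hypTerm, List.map_cons, List.map_nil,
        List.prod_cons, List.prod_nil, mul_one, rising_succ_left _ N, Nat.factorial_succ,
        sub_add_cancel, pow_succ]
      push_cast
      field_simp
      ring
    rw [key]
    ring

/-! ### The identity at `1` -/

section Five

variable {a b c d : ℂ}

theorem fourF3_summable (h : 0 < (c - a - b).re) (hc : NotNonposInt c)
    (hA : NotNonposInt (c + d - a)) (hB : NotNonposInt (c + d - b)) :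
    Summable (hypTerm [a, b, d, c + d - 1] [c, c + d - a, c + d - b] 1) := by
  refine hypTerm_summable rfl (by simp [hc, hA, hB]) (by simp) ?_
  simp at h ⊢
  linarith

theorem fourF3_shift_summable (h : 0 < (c - a - b).re) (hc : NotNonposInt c)
    (hA : NotNonposInt (c + d - a)) (hB : NotNonposInt (c + d - b)) :
    Summable (hypTerm [a + 1, b + 1, d + 1, c + d] [c + 1, c + d - a + 1, c + d - b + 1] 1) := by
  refine hypTerm_summable rfl (by simp [hc.add_one, hA.add_one, hB.add_one]) (by simp) ?_
  simp at h ⊢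
  linarith

theorem vwpFive_tendsto (h : 0 < (c - a - b).re) (hc : NotNonposInt c)
    (hA : NotNonposInt (c + d - a)) (hB : NotNonposInt (c + d - b)) :
    Tendsto (fun N => ∑ k ∈ Finset.range N, vwpFive a b c d k) atTop
      (𝓝 (hyp [a, b, d, c + d - 1] [c, c + d - a, c + d - b] 1 +
        2 * a * b * d / (c * (c + d - a) * (c + d - b)) *
          hyp [a + 1, b + 1, d + 1, c + d] [c + 1, c + d - a + 1, c + d - b + 1] 1)) := by
  rw [← tendsto_add_atTop_iff_nat 1]
  simp only [vwpFive_partial_sum hc hA hB]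
  exact ((tendsto_add_atTop_iff_nat 1).2
    (hypConverges_of_summable (fourF3_summable h hc hA hB)).tendsto).add
    ((hypConverges_of_summable (fourF3_shift_summable h hc hA hB)).tendsto.const_mul _)

theorem vwpFive_recurrence (h : 0 < (c - a - b).re) (hc : NotNonposInt c)
    (hA : NotNonposInt (c + d - a)) (hB : NotNonposInt (c + d - b)) {s t : ℂ}
    (hs : Tendsto (fun N => ∑ k ∈ Finset.range N, vwpFive a b c d k) atTop (𝓝 s))
    (ht : Tendsto (fun N => ∑ k ∈ Finset.range N, vwpFive a b (c + 1) d k) atTop (𝓝 t)) :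
    c * (c - a - b) * (c + d - a) * (c + d - b) * s =
      (c - a) * (c - b) * (c + d) * (c + d - a - b) * t := by
  refine mul_eq_mul_of_telescope hs ht ?_ (vwpFive_telescope hc hA hB)
  -- The boundary term is a linear polynomial in `N` times a term of the shifted `₄F₃`, so both `N`
  -- times that term and the term itself must tend to zero.
  have h1 := natCast_mul_hypTerm_tendsto
    (as := [a + 1, b + 1, d + 1, c + d]) (bs := [c + 1, c + d - a + 1, c + d - b + 1]) (x := 1)
    rfl (by simp [hc.add_one, hA.add_one, hB.add_one]) (by simp) (by simp at h ⊢; linarith)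
  have h2 := (fourF3_shift_summable h hc hA hB).tendsto_atTop_zero
  have h3 := (h1.add (h2.const_mul (c + d + (c - a - b)))).const_mul (-(a * b * d))
  rw [mul_zero, add_zero, mul_zero] at h3
  refine h3.congr fun N => ?_
  have h4 : ((N).factorial : ℂ) ≠ 0 := by exact_mod_cast (N).factorial_ne_zero
  have h0 := hc.ne_zero
  have h1 := rising_ne_zero hc.add_one N
  have hA0 := hA.ne_zero
  have hA1 := rising_ne_zero hA.add_one N
  have hB0 := hB.ne_zero
  have hB1 := rising_ne_zero hB.add_one N
  simp only [hypTerm, List.map_cons, List.map_nil,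
    List.prod_cons, List.prod_nil, one_pow, mul_one, rising_succ_left _ N]
  field_simp
  ring

theorem vwpFive_sum (h : 0 < (c - a - b).re) (hc : NotNonposInt c)
    (hA : NotNonposInt (c + d - a)) (hB : NotNonposInt (c + d - b)) :
    Complex.Gamma c * Complex.Gamma (c - a - b) *
          Complex.Gamma (c + d - a) * Complex.Gamma (c + d - b) /
        (Complex.Gamma (c - a) * Complex.Gamma (c - b) *
          Complex.Gamma (c + d) * Complex.Gamma (c + d - a - b)) =
      hyp [a, b, d, c + d - 1] [c, c + d - a, c + d - b] 1 +
        2 * a * b * d / (c * (c + d - a) * (c + d - b)) *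
          hyp [a + 1, b + 1, d + 1, c + d] [c + 1, c + d - a + 1, c + d - b + 1] 1 := by
  have hn : ∀ n : ℕ, 0 < (c + n - a - b).re := fun n => by
    simp at h ⊢
    linarith [n.cast_nonneg (α := ℝ)]
  have hAn : ∀ n : ℕ, NotNonposInt (c + n + d - a) := fun n => by
    simpa [show c + n + d - a = c + d - a + n by ring] using hA.add_natCast n
  have hBn : ∀ n : ℕ, NotNonposInt (c + n + d - b) := fun n => by
    simpa [show c + n + d - b = c + d - b + n by ring] using hB.add_natCast n
  have hlim := fun n : ℕ => vwpFive_tendsto (hn n) (hc.add_natCast n) (hAn n) (hBn n)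
  have hex : ∃ S : ℕ → ℂ, ∀ n : ℕ,
      Tendsto (fun N => ∑ k ∈ Finset.range N, vwpFive a b (c + n) d k) atTop (𝓝 (S n)) :=
    ⟨_, hlim⟩
  obtain ⟨S, hS⟩ := hex
  have hS0 := tendsto_nhds_unique (hlim 0) (hS 0)
  simp only [Nat.cast_zero, add_zero] at hS0
  rw [hS0]
  have hiter : ∀ n : ℕ, S 0 * (rising c n * rising (c - a - b) n * rising (c + d - a) n *
      rising (c + d - b) n) = rising (c - a) n * rising (c - b) n * rising (c + d) n *
        rising (c + d - a - b) n * S n := by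
    intro n
    induction n with
    | zero => simp
    | succ n ih =>
      have h1 := vwpFive_recurrence (hn n) (hc.add_natCast n) (hAn n) (hBn n) (hS n)
        (by simpa [add_assoc] using hS (n + 1))
      simp only [rising_succ]
      linear_combination (c + n) * (c - a - b + n) * (c + d - a + n) * (c + d - b + n) * ih +
        rising (c - a) n * rising (c - b) n * rising (c + d) n * rising (c + d - a - b) n * h1
  have hone : Tendsto S atTop (𝓝 1) := by
    -- Large enough for the majorant series, with upper parameters `a, b, d, r + ‖a‖` and lower
    -- parameters `r, r, r`, to converge.
    set r : ℝ := 1 + 2 * ‖a‖ + ‖b‖ + ‖d‖ with hr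
    have hr0 : 0 < r := by positivity
    have hrn := notNonposInt_ofReal hr0
    have hD : Summable (hypTerm [a, b, d, (r + ‖a‖ : ℝ)] [(r : ℂ), (r : ℂ), (r : ℂ)] 1) := by
      refine hypTerm_summable rfl (by simp [hrn]) (by simp) ?_
      simp [hr]
      linarith [Complex.re_le_norm a, Complex.re_le_norm b, Complex.re_le_norm d, norm_nonneg a,
        norm_nonneg b, norm_nonneg d]
    refine tendsto_one_of_norm_le
      (D := fun k => ‖hypTerm [a, b, d, (r + ‖a‖ : ℝ)] [(r : ℂ), (r : ℂ), (r : ℂ)] 1 (k + 1)‖)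
      (ε := fun n : ℕ => 2 * r / ‖c + d - b + n‖)
      ((summable_nat_add_iff 1).2 hD.norm) (tendsto_const_div_norm_add_natCast _ _)
      (fun n => by simp [vwpFive, wpRatio, wpFactor]) ?_ hS
    filter_upwards [eventually_le_re_add_natCast r c, eventually_le_re_add_natCast 1 (c + d),
      eventually_le_re_add_natCast r (c + d - a),
      eventually_le_re_add_natCast r (c + d - b)] with n h1 h2 h3 h4 k
    have e1 : c + d - b + n = c + n + d - b := by ring
    have e2 : c + d - a + n = c + n + d - a := by ring
    rw [e1] at h4 ⊢
    rw [e2] at h3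
    have h5 := norm_wpRatio_succ_le hr0 (a := a) (b := b) (e := c + n + d)
      (by rwa [add_right_comm]) h3 h4 k
    have h6 := norm_rising_le_of_le_re hr0 h1 (k + 1)
    have h7 : 0 < ‖rising r (k + 1)‖ := norm_pos_iff.2 (rising_ne_zero hrn _)
    have h8 : 0 < ‖c + n + d - b‖ := by linarith [Complex.re_le_norm (c + n + d - b)]
    rw [vwpFive, norm_mul]
    calc _ ≤ ‖rising a (k + 1) * rising b (k + 1) * rising d (k + 1)‖ /
          (‖rising r (k + 1)‖ * ‖((k + 1).factorial : ℂ)‖) * _ := by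
            rw [norm_div, norm_mul (rising (c + n) (k + 1))]
            have : 0 < ‖((k + 1).factorial : ℂ)‖ :=
              norm_pos_iff.2 (by exact_mod_cast (k + 1).factorial_ne_zero)
            exact mul_le_mul (by gcongr) h5 (norm_nonneg _) (by positivity)
      _ = _ := by
        simp only [hypTerm, List.map_cons, List.map_nil, List.prod_cons, List.prod_nil, one_pow,
          mul_one, norm_mul, norm_div, norm_one]
        field_simp
  have h1 := mul_Gamma_inv_eq_of_rising hone (by ring) hiter
  have h2 := hc.Gamma_ne_zero
  have h3 := (notNonposInt_of_re_pos h).Gamma_ne_zero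
  have h4 := hA.Gamma_ne_zero
  have h5 := hB.Gamma_ne_zero
  rw [div_eq_mul_inv, mul_inv, mul_inv, mul_inv, ← h1]
  field_simp

end Five

/-! ### Conditional convergence at `-1` and terminating series -/

/-- Summation by parts: the partial sum up to `N` is half of `h 0 - (-1) ^ N * h N` plus the
alternating sum of the differences, and the latter converges absolutely. -/
theorem hasSum_alternating {h : ℕ → ℂ} (h0 : Tendsto h atTop (𝓝 0))
    (hs : Summable fun n => h n - h (n + 1)) :
    Summable (fun n => (-1) ^ n * h n) (SummationFilter.conditional ℕ) := by
  have hs' : Summable fun n => (-1 : ℂ) ^ n * (h n - h (n + 1)) :=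
    Summable.of_norm (by simpa using hs.norm)
  have h1 : Tendsto (fun n => (-1 : ℂ) ^ n * h n) atTop (𝓝 0) := by
    rw [tendsto_zero_iff_norm_tendsto_zero] at h0 ⊢
    simpa using h0
  refine ⟨_, hasSum_conditional_iff.2 ((((tendsto_const_nhds (x := h 0)).sub h1).add
    hs'.hasSum.tendsto_sum_nat).const_mul (1 / 2) |>.congr fun N => ?_)⟩
  induction N with
  | zero => simp
  | succ N ih =>
    rw [Finset.sum_range_succ _ N, Finset.sum_range_succ _ N, ← ih, pow_succ]
    ring

theorem add_div_add_sub_one_isBigO (w : ℂ) {z : ℂ} (hz : NotNonposInt z) :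
    (fun n : ℕ => (w + n) / (z + n) - 1) =O[atTop] fun n : ℕ => (n : ℝ)⁻¹ := by
  have h1 : (fun n : ℕ => (n : ℂ)⁻¹) =O[atTop] fun n : ℕ => (n : ℝ)⁻¹ :=
    IsBigO.of_bound 1 (Eventually.of_forall fun n => by simp)
  have h := (((tendsto_natCast_div_add z).isBigO_one ℝ).mul h1).const_mul_left (w - z)
  simp only [one_mul] at h
  refine h.congr' ?_ EventuallyEq.rfl
  filter_upwards [eventually_ne_atTop 0] with n hn
  have hn : (n : ℂ) ≠ 0 := by exact_mod_cast hn
  have h2 : z + n ≠ 0 := (hz.add_natCast n).ne_zero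
  rw [add_comm (n : ℂ) z]
  field_simp
  ring

theorem add_div_add_isBigO_one (w : ℂ) {z : ℂ} (hz : NotNonposInt z) :
    (fun n : ℕ => (w + n) / (z + n)) =O[atTop] fun _ : ℕ => (1 : ℝ) := by
  have h1 : (fun n : ℕ => (n : ℝ)⁻¹) =O[atTop] fun _ : ℕ => (1 : ℝ) :=
    (tendsto_inv_atTop_nhds_zero_nat (𝕜 := ℝ)).isBigO_one ℝ
  have h2 : (fun _ : ℕ => (1 : ℂ)) =O[atTop] fun _ : ℕ => (1 : ℝ) :=
    isBigO_const_const _ one_ne_zero _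
  simpa using ((add_div_add_sub_one_isBigO w hz).trans h1).add h2

theorem hypTerm_neg (as bs : List ℂ) (x : ℂ) (n : ℕ) :
    hypTerm as bs (-x) n = (-1) ^ n * hypTerm as bs x n := by
  rw [hypTerm, hypTerm, neg_pow]; ring

theorem hypConverges_threeFTwo_neg_one {a b c d e : ℂ} (hd : NotNonposInt d)
    (he : NotNonposInt e) (h : (a + b + c).re < (d + e).re + 1) :
    HypConverges [a, b, c] [d, e] (-1) := by
  have hO := hypTerm_isBigO (as := [a, b, c]) (bs := [d, e]) (x := 1) rfl (by simp [hd, he])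
    (by simp)
  have hp : [a, b, c].sum.re - [d, e].sum.re - 1 < 0 := by
    simp at h ⊢
    linarith
  have h0 := tendsto_zero_of_isBigO_rpow hO hp
  have key := hasSum_alternating h0 ?_
  · simpa only [HypConverges, ← hypTerm_neg] using key
  set p := [a, b, c].sum.re - [d, e].sum.re - 1
  have h1 := notNonposInt_of_re_pos (x := 1) (by simp)
  -- The ratio of consecutive terms is `1 + O(1/n)`, so differencing gains a power of `n`: terms
  -- that are merely `O(n ^ p)` with `p < 0` have summable differences.
  have q : (fun n : ℕ => (a + n) / (d + n) * ((b + n) / (e + n)) * ((c + n) / (1 + n)) - 1)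
      =O[atTop] fun n : ℕ => (n : ℝ)⁻¹ := by
    have := ((((add_div_add_sub_one_isBigO a hd).mul (add_div_add_isBigO_one b he)).mul
      (add_div_add_isBigO_one c h1)).add ((add_div_add_sub_one_isBigO b he).mul
      (add_div_add_isBigO_one c h1) |>.congr_right fun n => (mul_one _).symm)).add
      ((add_div_add_sub_one_isBigO c h1).congr_right fun n => by simp)
    refine (this.congr_left fun n => ?_).congr_right fun n => by simp
    ring
  refine summable_of_isBigO_nat (g := fun n : ℕ => (n : ℝ) ^ (p - 1))
    (Real.summable_nat_rpow.2 (by linarith)) ?_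
  refine ((hO.mul q).neg_left).congr' (Eventually.of_forall fun n => ?_) ?_
  · have h2 := rising_ne_zero hd n
    have h3 := rising_ne_zero he n
    have h4 := (hd.add_natCast n).ne_zero
    have h5 := (he.add_natCast n).ne_zero
    have h6 : ((n).factorial : ℂ) ≠ 0 := by exact_mod_cast (n).factorial_ne_zero
    have h7 : 1 + (n : ℂ) ≠ 0 := (h1.add_natCast n).ne_zero
    have h8 : (n : ℂ) + 1 ≠ 0 := by rwa [add_comm]
    simp only [hypTerm, List.map_cons, List.map_nil, List.prod_cons, List.prod_nil, one_pow,
      mul_one, rising_succ, Nat.factorial_succ]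
    push_cast
    field_simp
    ring
  · filter_upwards [eventually_gt_atTop 0] with n hn
    have hn : (0 : ℝ) < n := by exact_mod_cast hn
    rw [Real.rpow_sub hn p 1, Real.rpow_one, div_eq_mul_inv]

theorem hypTerm_eq_zero {as : List ℂ} {k : ℕ} (h : -(k : ℂ) ∈ as) (bs : List ℂ) (x : ℂ) {n : ℕ}
    (hn : k < n) : hypTerm as bs x n = 0 := by
  have h1 : (as.map fun a => rising a n).prod = 0 :=
    List.prod_eq_zero (List.mem_map.2 ⟨_, h, rising_neg_natCast k n hn⟩)
  rw [hypTerm, h1]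
  simp

theorem hypTerm_summable_of_neg_natCast_mem {as : List ℂ} {k : ℕ} (h : -(k : ℂ) ∈ as)
    (bs : List ℂ) (x : ℂ) : Summable (hypTerm as bs x) :=
  summable_of_ne_finset_zero (s := Finset.range (k + 1)) fun n hn =>
    hypTerm_eq_zero h bs x (by simpa using hn)

/-! ### The identity at `-1` -/

section Four

variable {a b e : ℂ}

theorem vwpFour_series_converge (hA : NotNonposInt (e - a)) (hB : NotNonposInt (e - b))
    (h : -1 < (e - 2 * a - 2 * b).re ∨
      ∃ k : ℕ, a + 1 = -(k : ℂ) ∨ b + 1 = -(k : ℂ) ∨ e = -(k : ℂ)) :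
    HypConverges [a, b, e - 1] [e - a, e - b] (-1) ∧
      HypConverges [a + 1, b + 1, e] [e - a + 1, e - b + 1] (-1) ∧
      Tendsto (hypTerm [a + 1, b + 1, e] [e - a + 1, e - b + 1] (-1)) atTop (𝓝 0) := by
  rcases h with h | ⟨k, h⟩
  · refine ⟨hypConverges_of_summable (hypTerm_summable rfl (by simp [hA, hB]) (by simp) ?_),
      hypConverges_threeFTwo_neg_one hA.add_one hB.add_one ?_,
      tendsto_zero_of_isBigO_rpow (hypTerm_isBigO rfl (by simp [hA.add_one, hB.add_one])
        (by simp)) ?_⟩ <;>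
    · simp at h ⊢
      linarith
  · have h2 : -(k : ℂ) ∈ [a + 1, b + 1, e] := by
      rcases h with h | h | h <;> simp [h]
    have h1 : -((k + 1 : ℕ) : ℂ) ∈ [a, b, e - 1] := by
      push_cast
      rcases h with h | h | h
      · have : a = -(k + 1) := by linear_combination h
        simp [this]
      · have : b = -(k + 1) := by linear_combination h
        simp [this]
      · have : e - 1 = -(k + 1) := by linear_combination h
        simp [this]
    have s2 := hypTerm_summable_of_neg_natCast_mem h2 [e - a + 1, e - b + 1] (-1)
    exact ⟨hypConverges_of_summable (hypTerm_summable_of_neg_natCast_mem h1 _ _),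
      hypConverges_of_summable s2, s2.tendsto_atTop_zero⟩

theorem vwpFour_tendsto (hA : NotNonposInt (e - a)) (hB : NotNonposInt (e - b))
    (h1 : HypConverges [a, b, e - 1] [e - a, e - b] (-1))
    (h2 : HypConverges [a + 1, b + 1, e] [e - a + 1, e - b + 1] (-1)) :
    Tendsto (fun N => ∑ k ∈ Finset.range N, vwpFour a b e k) atTop
      (𝓝 (hyp [a, b, e - 1] [e - a, e - b] (-1) -
        2 * a * b / ((e - a) * (e - b)) *
          hyp [a + 1, b + 1, e] [e - a + 1, e - b + 1] (-1))) := by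
  rw [← tendsto_add_atTop_iff_nat 1]
  simp only [vwpFour_partial_sum hA hB]
  exact ((tendsto_add_atTop_iff_nat 1).2 h1.tendsto).sub (h2.tendsto.const_mul _)

theorem vwpFour_telescope_hypTerm (hA : NotNonposInt (e - a)) (hB : NotNonposInt (e - b)) (N : ℕ) :
    (e - a) * (e - b) * ∑ k ∈ Finset.range (N + 1), vwpFour a b e k =
      e * (e - a - b) * ∑ k ∈ Finset.range (N + 1), vwpFour a b (e + 1) k +
      a * b * hypTerm [a + 1, b + 1, e] [e - a + 1, e - b + 1] (-1) N := by
  rw [vwpFour_telescope hA hB]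
  congr 1
  have h4 : ((N).factorial : ℂ) ≠ 0 := by exact_mod_cast (N).factorial_ne_zero
  have hA0 := hA.ne_zero
  have hA1 := rising_ne_zero hA.add_one N
  have hB0 := hB.ne_zero
  have hB1 := rising_ne_zero hB.add_one N
  simp only [hypTerm, List.map_cons, List.map_nil, List.prod_cons, List.prod_nil, mul_one,
    rising_succ_left _ N]
  field_simp

theorem vwpFour_tendsto_one (a b e : ℂ) {S : ℕ → ℂ} (hS : ∀ n : ℕ,
    Tendsto (fun N => ∑ k ∈ Finset.range N, vwpFour a b (e + n) k) atTop (𝓝 (S n))) :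
    Tendsto S atTop (𝓝 1) := by
  set r : ℝ := 1 + 2 * ‖a‖ + ‖b‖ with hr
  have hr0 : 0 < r := by positivity
  have hrn := notNonposInt_ofReal hr0
  have hD : Summable (hypTerm [a, b, (r + ‖a‖ : ℝ)] [(r : ℂ), (r : ℂ)] 1) := by
    refine hypTerm_summable rfl (by simp [hrn]) (by simp) ?_
    simp [hr]
    linarith [Complex.re_le_norm a, Complex.re_le_norm b, norm_nonneg a, norm_nonneg b]
  refine tendsto_one_of_norm_le
    (D := fun k => ‖hypTerm [a, b, (r + ‖a‖ : ℝ)] [(r : ℂ), (r : ℂ)] 1 (k + 1)‖)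
    (ε := fun n : ℕ => 2 * r / ‖e - b + n‖)
    ((summable_nat_add_iff 1).2 hD.norm) (tendsto_const_div_norm_add_natCast _ _)
    (fun n => by simp [vwpFour, wpRatio, wpFactor]) ?_ hS
  filter_upwards [eventually_le_re_add_natCast 1 e, eventually_le_re_add_natCast r (e - a),
    eventually_le_re_add_natCast r (e - b)] with n h2 h3 h4 k
  rw [sub_add_eq_add_sub] at h3 h4 ⊢
  have h5 := norm_wpRatio_succ_le hr0 h2 h3 h4 k
  rw [vwpFour, norm_mul]
  calc _ ≤ _ := mul_le_mul_of_nonneg_left h5 (norm_nonneg _)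
    _ = _ := by
      simp only [hypTerm, List.map_cons, List.map_nil, List.prod_cons, List.prod_nil, one_pow,
        mul_one, norm_mul, norm_div, norm_one, norm_pow, norm_neg, one_mul]
      ring

/-- The admitted conditions are those that survive `e ↦ e + n`, so every shifted series converges
and the recurrence can be iterated indefinitely. -/
theorem vwpFour_sum_of_persistent (hA : NotNonposInt (e - a)) (hB : NotNonposInt (e - b))
    (h : -1 < (e - 2 * a - 2 * b).re ∨ ∃ k : ℕ, a + 1 = -(k : ℂ) ∨ b + 1 = -(k : ℂ)) :
    Tendsto (fun N => ∑ k ∈ Finset.range N, vwpFour a b e k) atTop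
      (𝓝 (Complex.Gamma (e - a) * Complex.Gamma (e - b) /
        (Complex.Gamma e * Complex.Gamma (e - a - b)))) := by
  have hAn : ∀ n : ℕ, NotNonposInt (e + n - a) := fun n => by
    simpa [sub_add_eq_add_sub] using hA.add_natCast n
  have hBn : ∀ n : ℕ, NotNonposInt (e + n - b) := fun n => by
    simpa [sub_add_eq_add_sub] using hB.add_natCast n
  have hn : ∀ n : ℕ, -1 < (e + n - 2 * a - 2 * b).re ∨
      ∃ k : ℕ, a + 1 = -(k : ℂ) ∨ b + 1 = -(k : ℂ) ∨ e + n = -(k : ℂ) := fun n => by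
    rcases h with h | ⟨k, h | h⟩
    · left
      simp at h ⊢
      linarith [n.cast_nonneg (α := ℝ)]
    · exact Or.inr ⟨k, Or.inl h⟩
    · exact Or.inr ⟨k, Or.inr (Or.inl h)⟩
  have hconv := fun n => vwpFour_series_converge (hAn n) (hBn n) (hn n)
  have hex : ∃ S : ℕ → ℂ, ∀ n : ℕ,
      Tendsto (fun N => ∑ k ∈ Finset.range N, vwpFour a b (e + n) k) atTop (𝓝 (S n)) :=
    ⟨_, fun n => vwpFour_tendsto (hAn n) (hBn n) (hconv n).1 (hconv n).2.1⟩
  obtain ⟨S, hS⟩ := hex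
  have hiter : ∀ n : ℕ, S 0 * (rising (e - a) n * rising (e - b) n * rising 1 n * rising 1 n) =
      rising e n * rising (e - a - b) n * rising 1 n * rising 1 n * S n := by
    intro n
    induction n with
    | zero => simp
    | succ n ih =>
      have hg := (hconv n).2.2.const_mul (a * b)
      rw [mul_zero] at hg
      have h1 := mul_eq_mul_of_telescope (hS n)
        (by simpa [add_assoc] using hS (n + 1)) hg (vwpFour_telescope_hypTerm (hAn n) (hBn n))
      simp only [rising_succ]
      linear_combination (e - a + n) * (e - b + n) * (1 + n) ^ 2 * ih +
        rising e n * rising (e - a - b) n * rising 1 n * rising 1 n * (1 + n) ^ 2 * h1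
  have h1 := mul_Gamma_inv_eq_of_rising (vwpFour_tendsto_one a b e hS) (by ring) hiter
  simp only [Complex.Gamma_one, inv_one, mul_one] at h1
  have h4 := hA.Gamma_ne_zero
  have h5 := hB.Gamma_ne_zero
  have h6 : S 0 = Complex.Gamma (e - a) * Complex.Gamma (e - b) /
      (Complex.Gamma e * Complex.Gamma (e - a - b)) := by
    rw [div_eq_mul_inv, mul_inv, ← h1]
    field_simp
  simpa [h6] using hS 0

/-- Termination caused by `e` is lost under large shifts. At `e = 0`, however, the recurrence has
right-hand coefficient zero, so the partial sums reduce to the boundary term; the value `0` is then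
carried down to `e = -1, -2, …`. -/
theorem vwpFour_sum_of_neg_natCast (k : ℕ) (he : e = -(k : ℂ)) (hA : NotNonposInt (e - a))
    (hB : NotNonposInt (e - b)) :
    Tendsto (fun N => ∑ k ∈ Finset.range N, vwpFour a b e k) atTop (𝓝 0) := by
  induction k generalizing e with
  | zero =>
    have hconv := vwpFour_series_converge hA hB (Or.inr ⟨0, Or.inr (Or.inr he)⟩)
    have h := (hconv.2.2.const_mul (a * b)).const_mul (((e - a) * (e - b))⁻¹)
    simp only [mul_zero] at h
    rw [← tendsto_add_atTop_iff_nat 1]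
    refine h.congr fun N => ?_
    have h1 := vwpFour_telescope_hypTerm hA hB N
    have h2 : e = 0 := by simpa using he
    have hA0 := hA.ne_zero
    have hB0 := hB.ne_zero
    rw [inv_mul_eq_iff_eq_mul₀ (mul_ne_zero hA0 hB0), h1, h2]
    ring
  | succ k ih =>
    have hconv := vwpFour_series_converge hA hB (Or.inr ⟨k + 1, Or.inr (Or.inr he)⟩)
    have h1 := ih (e := e + 1) (by rw [he]; push_cast; ring)
      (by simpa [sub_add_eq_add_sub] using hA.add_one)
      (by simpa [sub_add_eq_add_sub] using hB.add_one)
    have hg := hconv.2.2.const_mul (a * b)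
    rw [mul_zero] at hg
    have h2 := vwpFour_tendsto hA hB hconv.1 hconv.2.1
    have h3 := mul_eq_mul_of_telescope h2 h1 hg (vwpFour_telescope_hypTerm hA hB)
    rw [mul_zero] at h3
    rwa [(mul_eq_zero.1 h3).resolve_left (mul_ne_zero hA.ne_zero hB.ne_zero)] at h2

theorem vwpFour_sum (hA : NotNonposInt (e - a)) (hB : NotNonposInt (e - b))
    (h : -1 < (e - 2 * a - 2 * b).re ∨
      ∃ k : ℕ, a + 1 = -(k : ℂ) ∨ b + 1 = -(k : ℂ) ∨ e = -(k : ℂ)) :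
    Complex.Gamma (e - a) * Complex.Gamma (e - b) /
        (Complex.Gamma e * Complex.Gamma (e - a - b)) =
      hyp [a, b, e - 1] [e - a, e - b] (-1) -
        2 * a * b / ((e - a) * (e - b)) *
          hyp [a + 1, b + 1, e] [e - a + 1, e - b + 1] (-1) := by
  have hconv := vwpFour_series_converge hA hB h
  refine tendsto_nhds_unique ?_ (vwpFour_tendsto hA hB hconv.1 hconv.2.1)
  by_cases he : ∃ k : ℕ, e = -(k : ℂ)
  · obtain ⟨k, he⟩ := he
    have h1 : Complex.Gamma e = 0 := by rw [he, Complex.Gamma_neg_nat_eq_zero]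
    simpa [h1] using vwpFour_sum_of_neg_natCast k he hA hB
  · refine vwpFour_sum_of_persistent hA hB (h.imp_right fun ⟨k, hk⟩ => ⟨k, ?_⟩)
    rcases hk with hk | hk | hk
    · exact Or.inl hk
    · exact Or.inr hk
    · exact absurd ⟨k, hk⟩ he

end Four

/-! ### Integrals against the beta density -/

/-- The **Chu–Vandermonde identity**. -/
theorem chu_vandermonde (b x : ℂ) (n : ℕ) :
    ∑ m ∈ Finset.range (n + 1), (n.choose m : ℂ) * ((-1) ^ m * rising b m * rising (x + m) (n - m)) =
      rising (x - b) n := by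
  induction n generalizing b x with
  | zero => simp
  | succ n ih =>
    -- Pascal's rule splits the sum in two. Both are multiples of `(x - b)^(n)`, with factors `x +
    -- n` and `-b` that add up to the missing factor `x - b + n`.
    rw [Finset.sum_choose_succ_mul (fun i j => (-1) ^ i * rising b i * rising (x + i) j)]
    have h1 : ∑ m ∈ Finset.range (n + 1), (n.choose m : ℂ) *
        ((-1) ^ m * rising b m * rising (x + m) (n + 1 - m)) = (x + n) * rising (x - b) n := by
      rw [← ih, Finset.mul_sum]
      refine Finset.sum_congr rfl fun m hm => ?_
      have hm : m ≤ n := Nat.lt_succ_iff.1 (Finset.mem_range.1 hm)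
      rw [Nat.succ_sub hm, rising_succ, Nat.cast_sub hm]
      ring
    have h2 : ∑ m ∈ Finset.range (n + 1), (n.choose m : ℂ) *
        ((-1) ^ (m + 1) * rising b (m + 1) * rising (x + (m + 1 : ℕ)) (n - m)) =
        -b * rising (x - b) n := by
      rw [show x - b = (x + 1) - (b + 1) by ring, ← ih, Finset.mul_sum]
      refine Finset.sum_congr rfl fun m _ => ?_
      rw [rising_succ_left, pow_succ]
      push_cast
      rw [show x + 1 + (m : ℂ) = x + (m + 1) by ring]
      ring
    rw [h1, h2, rising_succ]
    ring

/-- Poles of Gamma are allowed: if `z` is a pole and the rising factorial is nonzero, then `z + n`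
is a pole as well and both sides are `0`. -/
theorem Gamma_add_natCast_of_rising_ne_zero {z : ℂ} {n : ℕ} (h : rising z n ≠ 0) :
    Complex.Gamma (z + n) = rising z n * Complex.Gamma z := by
  induction n with
  | zero => simp
  | succ n ih =>
    rw [rising_succ] at h ⊢
    push_cast
    rw [← add_assoc, Complex.Gamma_add_one _ (right_ne_zero_of_mul h), ih (left_ne_zero_of_mul h)]
    ring

theorem ofReal_beta (f d : ℝ) :
    (beta f d : ℂ) = Complex.Gamma f * Complex.Gamma d / Complex.Gamma (f + d) := by
  rw [beta]
  push_cast [← Complex.Gamma_ofReal]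
  rfl

/-- Restricted to the open interval because `betaPDFReal` is set to `0` at the endpoints, where the
complex powers need not vanish. -/
theorem pow_mul_betaPDF_eqOn (f d : ℝ) (k m : ℕ) :
    Set.EqOn (fun x : ℝ => (-1) ^ m / (beta f d : ℂ) *
        ((x : ℂ) ^ (((f + k : ℂ)) - 1) * (1 - (x : ℂ)) ^ ((d + m : ℂ) - 1)))
      (fun x : ℝ => (x : ℂ) ^ k * (x - 1) ^ m * (betaPDFReal f d x : ℂ)) (Set.Ioo 0 1) := by
  intro x hx
  have h0 : (x : ℂ) ≠ 0 := by exact_mod_cast hx.1.ne'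
  have h1 : 1 - (x : ℂ) ≠ 0 := by exact_mod_cast (sub_pos.2 hx.2).ne'
  simp only [betaPDFReal, hx.1, hx.2, and_self, if_true]
  rw [add_sub_right_comm (f : ℂ), add_sub_right_comm (d : ℂ), Complex.cpow_add _ _ h0,
    Complex.cpow_add _ _ h1, Complex.cpow_natCast, Complex.cpow_natCast]
  push_cast
  rw [Complex.ofReal_cpow hx.1.le, Complex.ofReal_cpow (sub_pos.2 hx.2).le]
  push_cast
  rw [show (x : ℂ) - 1 = -1 * (1 - x) by ring, mul_pow]
  ring

theorem intervalIntegrable_pow_mul_betaPDF {f d : ℝ} (hf : 0 < f) (hd : 0 < d) (k m : ℕ) :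
    IntervalIntegrable (fun x : ℝ => (x : ℂ) ^ k * (x - 1) ^ m * (betaPDFReal f d x : ℂ))
      MeasureTheory.volume 0 1 := by
  have h := (Complex.betaIntegral_convergent (u := f + k) (v := d + m)
    (by simp; positivity) (by simp; positivity)).const_mul ((-1) ^ m / (beta f d : ℂ))
  refine h.congr_uIoo ?_
  rw [Set.uIoo_of_le zero_le_one]
  exact pow_mul_betaPDF_eqOn f d k m

theorem integral_pow_mul_betaPDF {f d : ℝ} (hf : 0 < f) (hd : 0 < d) (k m : ℕ) :
    ∫ x in (0 : ℝ)..1, (x : ℂ) ^ k * (x - 1) ^ m * (betaPDFReal f d x : ℂ) =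
      (-1) ^ m * rising f k * rising d m / rising (f + d) (k + m) := by
  have hfd : NotNonposInt ((f : ℂ) + d) := notNonposInt_of_re_pos (by simp; positivity)
  rw [← intervalIntegral.integral_congr_Ioo_of_le zero_le_one (pow_mul_betaPDF_eqOn f d k m),
    intervalIntegral.integral_const_mul, ← Complex.betaIntegral,
    Complex.betaIntegral_eq_Gamma_mul_div _ _ (by simp; positivity) (by simp; positivity),
    show (f : ℂ) + k + (d + m) = f + d + (k + m : ℕ) by push_cast; ring,
    Gamma_add_natCast_of_rising_ne_zero (rising_ne_zero (notNonposInt_ofReal hf) _),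
    Gamma_add_natCast_of_rising_ne_zero (rising_ne_zero (notNonposInt_ofReal hd) _),
    Gamma_add_natCast_of_rising_ne_zero (rising_ne_zero hfd _), ofReal_beta]
  have h1 := (notNonposInt_ofReal hf).Gamma_ne_zero
  have h2 := (notNonposInt_ofReal hd).Gamma_ne_zero
  have h3 := hfd.Gamma_ne_zero
  have h4 := rising_ne_zero hfd (k + m)
  field_simp

theorem intervalIntegrable_betaPDF {f d : ℝ} (hf : 0 < f) (hd : 0 < d) :
    IntervalIntegrable (fun x : ℝ => (betaPDFReal f d x : ℂ)) MeasureTheory.volume 0 1 := by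
  simpa using intervalIntegrable_pow_mul_betaPDF hf hd 0 0

theorem continuous_jacobiK (j : ℕ) (a b : ℂ) : Continuous fun x : ℝ => jacobiK j x a b := by
  unfold jacobiK
  fun_prop

/-- The moments of a Jacobi polynomial against its beta density. -/
theorem integral_pow_mul_jacobiK {f d : ℝ} (hf : 0 < f) (hd : 0 < d) (j k : ℕ) :
    ∫ x in (0 : ℝ)..1, (x : ℂ) ^ k * (jacobiK j x f d * (betaPDFReal f d x : ℂ)) =
      rising f k * rising d j * rising (k + 1 - j) j /
        ((j.factorial : ℂ) * rising (f + d) (k + j)) := by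
  have hfd : NotNonposInt ((f : ℂ) + d) := notNonposInt_of_re_pos (by simp; positivity)
  have e : ∀ x : ℝ, (x : ℂ) ^ k * (jacobiK j x f d * (betaPDFReal f d x : ℂ)) =
      ∑ m ∈ Finset.range (j + 1), 1 / (j.factorial : ℂ) * ((j.choose m : ℂ) *
        rising (f + d + j - 1) m * rising (d + m) (j - m)) *
          ((x : ℂ) ^ k * (x - 1) ^ m * (betaPDFReal f d x : ℂ)) := by
    intro x
    rw [jacobiK, Finset.mul_sum, Finset.sum_mul, Finset.mul_sum]
    refine Finset.sum_congr rfl fun m _ => ?_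
    ring
  simp only [e]
  rw [intervalIntegral.integral_finsetSum fun m _ =>
    (intervalIntegrable_pow_mul_betaPDF hf hd k m).const_mul _]
  simp only [intervalIntegral.integral_const_mul, integral_pow_mul_betaPDF hf hd]
  -- Chu–Vandermonde is applied with `x = f + d + k` and `b = f + d + j - 1`; the beta parameters
  -- cancel in `x - b`.
  rw [show (k : ℂ) + 1 - j = f + d + k - (f + d + j - 1) by ring, ← chu_vandermonde,
    Finset.mul_sum, Finset.sum_div]
  refine Finset.sum_congr rfl fun m hm => ?_
  have hm : m ≤ j := Nat.lt_succ_iff.1 (Finset.mem_range.1 hm)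
  have h1 : rising d j = rising d m * rising (d + m) (j - m) := by
    rw [← rising_add, Nat.add_sub_cancel' hm]
  have h2 : rising ((f : ℂ) + d) (k + j) =
      rising (f + d) (k + m) * rising (f + d + k + m) (j - m) := by
    rw [show (f : ℂ) + d + k + m = f + d + (k + m : ℕ) by push_cast; ring, ← rising_add]
    congr 1
    omega
  have h3 := rising_ne_zero hfd (k + j)
  have h4 : ((j).factorial : ℂ) ≠ 0 := by exact_mod_cast (j).factorial_ne_zero
  rw [h2] at h3
  have h5 := left_ne_zero_of_mul h3
  have h6 := right_ne_zero_of_mul h3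
  rw [h1, h2]
  field_simp

theorem ordinaryHypergeometric_eq_tsum_hypTerm (a b c x : ℂ) :
    ₂F₁ a b c x = ∑' k, hypTerm [a, b] [c] 1 k * x ^ k := by
  rw [ordinaryHypergeometric_eq_tsum]
  refine tsum_congr fun k => ?_
  simp only [hypTerm, rising, List.map_cons, List.map_nil, List.prod_cons, List.prod_nil, one_pow,
    mul_one, smul_eq_mul]
  ring

section Integral

variable {a b c : ℂ} {f d : ℝ}

theorem norm_hypTerm_mul_pow_le {x : ℝ} (hx : x ∈ Set.Icc (0 : ℝ) 1) (as bs : List ℂ) (k : ℕ) :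
    ‖hypTerm as bs 1 k * (x : ℂ) ^ k‖ ≤ ‖hypTerm as bs 1 k‖ := by
  rw [norm_mul, norm_pow, Complex.norm_of_nonneg hx.1]
  exact mul_le_of_le_one_right (norm_nonneg _) (pow_le_one₀ hx.1 hx.2)

theorem intervalIntegrable_hypJacobiBeta (hf : 0 < f) (hd : 0 < d) (h : 0 < (c - a - b).re)
    (hc : NotNonposInt c) (j : ℕ) :
    IntervalIntegrable (hypJacobiBeta a b c j f d) MeasureTheory.volume 0 1 := by
  refine (intervalIntegrable_betaPDF hf hd).continuousOn_mul
    (g := fun x : ℝ => ₂F₁ a b c (x : ℂ) * jacobiK j x f d) ?_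
  refine ContinuousOn.mul ?_ (continuous_jacobiK j f d).continuousOn
  simp only [ordinaryHypergeometric_eq_tsum_hypTerm]
  rw [Set.uIcc_of_le zero_le_one]
  exact continuousOn_tsum (fun k => by fun_prop) (gauss_summable h hc).norm
    fun k x hx => norm_hypTerm_mul_pow_le hx _ _ k

theorem hasSum_integral_hypJacobiBeta (hf : 0 < f) (hd : 0 < d) (h : 0 < (c - a - b).re)
    (hc : NotNonposInt c) (j : ℕ) :
    HasSum (fun k => hypTerm [a, b] [c] 1 k * (rising f k * rising d j * rising (k + 1 - j) j /
        ((j.factorial : ℂ) * rising (f + d) (k + j))))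
      (∫ x in (0 : ℝ)..1, hypJacobiBeta a b c j f d x) := by
  have hs := gauss_summable h hc
  set G : ℝ → ℂ := fun x => jacobiK j x f d * (betaPDFReal f d x : ℂ)
  have hG : IntervalIntegrable G MeasureTheory.volume 0 1 :=
    (intervalIntegrable_betaPDF hf hd).continuousOn_mul (continuous_jacobiK j f d).continuousOn
  -- On the interval `‖x ^ k‖ ≤ 1`, so the absolutely convergent coefficients at `1` times the
  -- integrable weight dominate.
  have key := intervalIntegral.hasSum_integral_of_dominated_convergence (a := 0) (b := 1)
    (μ := MeasureTheory.volume) (F := fun k x => hypTerm [a, b] [c] 1 k * ((x : ℂ) ^ k * G x))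
    (f := hypJacobiBeta a b c j f d) (fun k x => ‖hypTerm [a, b] [c] 1 k‖ * ‖G x‖) ?_ ?_ ?_ ?_ ?_
  · simp only [intervalIntegral.integral_const_mul] at key
    simpa only [G, integral_pow_mul_jacobiK hf hd] using key
  · intro k
    have : Continuous fun x : ℝ => (x : ℂ) ^ k := by fun_prop
    refine (this.aestronglyMeasurable.mul ?_).const_mul _
    exact hG.def'.aestronglyMeasurable
  · intro k
    refine Eventually.of_forall fun x hx => ?_
    rw [Set.uIoc_of_le zero_le_one] at hx
    rw [← mul_assoc, norm_mul _ (G x)]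
    exact mul_le_mul_of_nonneg_right (norm_hypTerm_mul_pow_le ⟨hx.1.le, hx.2⟩ _ _ k)
      (norm_nonneg _)
  · exact Eventually.of_forall fun x _ => hs.norm.mul_right _
  · simp only [tsum_mul_right]
    exact hG.norm.const_mul _
  · refine Eventually.of_forall fun x hx => ?_
    rw [Set.uIoc_of_le zero_le_one] at hx
    have h1 : Summable fun k => hypTerm [a, b] [c] 1 k * (x : ℂ) ^ k :=
      Summable.of_norm_bounded hs.norm fun k => norm_hypTerm_mul_pow_le ⟨hx.1.le, hx.2⟩ _ _ k
    have h2 := h1.hasSum.mul_right (G x)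
    rw [← ordinaryHypergeometric_eq_tsum_hypTerm] at h2
    simpa only [hypJacobiBeta, G, mul_assoc] using h2

theorem threeFTwo_summable (hf : 0 < f) (hd : 0 < d) (h : 0 < (c - a - b).re)
    (hc : NotNonposInt c) (j : ℕ) :
    Summable (hypTerm [a + j, b + j, f + j] [c + j, d + f + 2 * j] 1) := by
  have hfd : NotNonposInt ((d : ℂ) + f + 2 * j) := notNonposInt_of_re_pos (by simp; positivity)
  refine hypTerm_summable rfl (by simp [hc.add_natCast j, hfd]) (by simp) ?_
  simp at h ⊢
  linarith

theorem integral_hypJacobiBeta (hf : 0 < f) (hd : 0 < d) (h : 0 < (c - a - b).re)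
    (hc : NotNonposInt c) (j : ℕ) :
    ∫ x in (0 : ℝ)..1, hypJacobiBeta a b c j f d x =
      rising f j * rising d j * rising a j * rising b j /
          ((j.factorial : ℂ) * rising (f + d) (2 * j) * rising c j) *
        hyp [a + j, b + j, f + j] [c + j, d + f + 2 * j] 1 := by
  have hfd : NotNonposInt ((f : ℂ) + d) := notNonposInt_of_re_pos (by simp; positivity)
  have h1 := hasSum_integral_hypJacobiBeta hf hd h hc j
  have h2 := threeFTwo_summable hf hd h hc j
  rw [hyp_eq_tsum h2]
  refine h1.unique (((hasSum_nat_add_iff' j).1 ?_))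
  -- The terms with `k < j` vanish by orthogonality; for `k = i + j` the factor `(i + 1)^(j)`
  -- cancels against `(i + j)!`.
  rw [Finset.sum_eq_zero, sub_zero]
  · refine (h2.hasSum.mul_left _).congr_fun ?_
    intro i
    have e1 : ∀ x : ℂ, rising x (i + j) = rising x j * rising (x + j) i := fun x => by
      rw [add_comm, rising_add]
    have e2 : rising ((f : ℂ) + d) (i + j + j) =
        rising (f + d) (2 * j) * rising (d + f + 2 * j) i := by
      rw [show i + j + j = 2 * j + i by ring, rising_add, add_comm (f : ℂ) d]
      push_cast
      rfl
    have e3 := rising_natCast_add_one i j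
    have e4 : ((i + j : ℕ) : ℂ) + 1 - j = i + 1 := by push_cast; ring
    simp only [hypTerm, List.map_cons, List.map_nil, List.prod_cons, List.prod_nil, one_pow,
      mul_one]
    rw [e4, e2, e1, e1, e1, e1, ← e3]
    have h4 : rising ((i : ℂ) + 1) j ≠ 0 := by
      intro h
      rw [h, zero_mul] at e3
      exact (i + j).factorial_ne_zero (by exact_mod_cast e3.symm)
    have e5 := inv_mul_cancel₀ h4
    simp only [div_eq_mul_inv, mul_inv, one_mul]
    generalize (rising ((i : ℂ) + 1) j)⁻¹ = w at *
    linear_combination rising f j * rising d j * rising a j * rising b j *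
      ((j.factorial : ℂ)⁻¹ * (rising ((f : ℂ) + d) (2 * j))⁻¹ * (rising c j)⁻¹) *
      (rising (a + j) i * (rising (b + j) i * rising (f + j) i) *
        ((rising (c + j) i)⁻¹ * (rising ((d : ℂ) + f + 2 * j) i)⁻¹) * (i.factorial : ℂ)⁻¹) * e5
  · intro k hk
    have hk : k < j := Finset.mem_range.1 hk
    have : (k : ℂ) + 1 - j = -((j - 1 - k : ℕ) : ℂ) := by
      rw [Nat.cast_sub (by omega), Nat.cast_sub (by omega)]
      push_cast
      ring
    rw [this, rising_neg_natCast _ _ (by omega)]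
    simp

end Integral

theorem integral_hypJacobiBeta_of_eq {a b : ℂ} {c d : ℝ} (hc : 0 < c) (hd : 0 < d)
    (h : 0 < ((c : ℂ) - a - b).re) (j : ℕ) (ha : rising (d + c - a) j ≠ 0)
    (hb : rising (d + c - b) j ≠ 0) :
    ∫ x in (0 : ℝ)..1, hypJacobiBeta a b c j c d x =
      rising d j * rising a j * rising b j /
          ((j.factorial : ℂ) * rising (d + c - a) j * rising (d + c - b) j) *
        (Complex.Gamma (c + d) * Complex.Gamma (d + c - a - b) /
          (Complex.Gamma (d + c - a) * Complex.Gamma (d + c - b))) := by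
  have hcn := notNonposInt_ofReal hc
  have hfd : NotNonposInt ((c : ℂ) + d) := notNonposInt_of_re_pos (by simp; positivity)
  have hfd2 : NotNonposInt ((d : ℂ) + c + 2 * j) := notNonposInt_of_re_pos (by simp; positivity)
  have e1 : hyp [a + j, b + j, (c : ℂ) + j] [(c : ℂ) + j, d + c + 2 * j] 1 =
      hyp [a + j, b + j] [d + c + 2 * j] 1 := by
    unfold hyp
    congr 1
    ext n
    have := rising_ne_zero (hcn.add_natCast j) n
    simp only [hypTerm, List.map_cons, List.map_nil, List.prod_cons, List.prod_nil, one_pow,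
      mul_one]
    field_simp
  rw [integral_hypJacobiBeta hc hd h hcn j, e1,
    gauss_sum (by simp at h ⊢; linarith) hfd2,
    show (d : ℂ) + c + 2 * j - (a + j) - (b + j) = d + c - a - b by ring,
    show (d : ℂ) + c + 2 * j - (a + j) = d + c - a + j by ring,
    show (d : ℂ) + c + 2 * j - (b + j) = d + c - b + j by ring,
    Gamma_add_natCast_of_rising_ne_zero ha, Gamma_add_natCast_of_rising_ne_zero hb,
    show (d : ℂ) + c + 2 * j = c + d + (2 * j : ℕ) by push_cast; ring,
    Gamma_add_natCast_of_rising_ne_zero (rising_ne_zero hfd _)]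
  have h1 := rising_ne_zero hfd (2 * j)
  have h2 := rising_ne_zero hcn j
  field_simp

/-! ### The finite sum for a `₃F₂` with integer parameters -/

theorem rising_ne_zero_of_forall_lt {x : ℂ} {n : ℕ} (h : ∀ i < n, x ≠ -(i : ℂ)) :
    rising x n ≠ 0 := by
  rw [rising_eq_prod, Finset.prod_ne_zero_iff]
  intro i hi h0
  exact h i (Finset.mem_range.1 hi) (eq_neg_of_add_eq_zero_left h0)

/-- Gauss's theorem for the parameters `a - p`, `b - p`, `c - p`, without the first `p` terms. -/
theorem hasSum_gauss_shift {a b c : ℂ} (h : 0 < (c - a - b).re) {p : ℕ}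
    (hc : NotNonposInt (c - p)) (ha : rising (a - p) p ≠ 0) (hb : rising (b - p) p ≠ 0) :
    HasSum (fun k : ℕ => rising a k * rising b k / (rising c k * ((k + p).factorial : ℂ)))
      (rising (c - p) p / (rising (a - p) p * rising (b - p) p) *
        (Complex.Gamma (c - p) * Complex.Gamma (c - a - b + p) /
          (Complex.Gamma (c - a) * Complex.Gamma (c - b)) -
          ∑ k ∈ Finset.range p, hypTerm [a - p, b - p] [c - p] 1 k)) := by
  have h1 : 0 < (c - p - (a - p) - (b - p)).re := by
    simp at h ⊢
    linarith [p.cast_nonneg (α := ℝ)]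
  have h2 := gauss_summable h1 hc
  have h3 := gauss_sum h1 hc
  rw [show c - p - (a - p) - (b - p) = c - a - b + p by ring,
    show c - p - (a - p) = c - a by ring, show c - p - (b - p) = c - b by ring,
    hyp_eq_tsum h2] at h3
  rw [← h3]
  refine (((hasSum_nat_add_iff' p).2 h2.hasSum).mul_left _).congr_fun fun k => ?_
  have e : ∀ x : ℂ, rising (x - p) (k + p) = rising (x - p) p * rising x k := fun x => by
    rw [add_comm, rising_add, sub_add_cancel]
  have h4 := rising_ne_zero hc (k + p)
  simp only [hypTerm, List.map_cons, List.map_nil, List.prod_cons, List.prod_nil, one_pow,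
    mul_one]
  rw [e] at h4
  have h5 := left_ne_zero_of_mul h4
  have h6 := right_ne_zero_of_mul h4
  rw [e, e, e]
  field_simp

/-- Over the common denominator `(k + m + n)!` the numerators are rising factorials of `k + m + 1 +
j`, and Chu–Vandermonde applies with `x = k + m + 1` and `b = n + m`. -/
theorem sum_choose_div_factorial (n m k : ℕ) :
    ∑ j ∈ Finset.range (n + 1), (-1) ^ j * (n.choose j : ℂ) *
        (rising (n + m) j / ((k + (m + j)).factorial : ℂ)) =
      rising (k + 1 - n) n / ((k + m + n).factorial : ℂ) := by
  rw [show (k : ℂ) + 1 - n = (k + m + 1) - (n + m) by ring, ← chu_vandermonde, Finset.sum_div]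
  refine Finset.sum_congr rfl fun j hj => ?_
  have hj : j ≤ n := Nat.lt_succ_iff.1 (Finset.mem_range.1 hj)
  have h1 := rising_natCast_add_one (k + (m + j)) (n - j)
  rw [show k + (m + j) + (n - j) = k + m + n by omega] at h1
  push_cast at h1
  rw [show (k : ℂ) + (m + j) + 1 = k + m + 1 + j by ring] at h1
  have h2 : ((k + (m + j)).factorial : ℂ) ≠ 0 := by
    exact_mod_cast (k + (m + j)).factorial_ne_zero
  have h3 : ((k + m + n).factorial : ℂ) ≠ 0 := by exact_mod_cast (k + m + n).factorial_ne_zero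
  rw [mul_div_assoc', div_eq_div_iff h2 h3, ← h1]
  ring

theorem threeFTwo_one_summable {a b c : ℂ} (h : 0 < (c - a - b).re) (hc : NotNonposInt c)
    (n m : ℕ) : Summable (hypTerm [a + n, b + n, 1 + n] [c + n, 1 + m + 2 * n] 1) := by
  have h1 : NotNonposInt ((1 : ℂ) + m + 2 * n) := notNonposInt_of_re_pos (by simp; positivity)
  refine hypTerm_summable rfl (by simp [hc.add_natCast n, h1]) (by simp) ?_
  simp at h ⊢
  linarith [m.cast_nonneg (α := ℝ)]

/-- The factor `(k + 1 - n)^(n)` kills the terms with `k < n`; the remaining ones, reindexed, are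
those of the `₃F₂` up to a constant. -/
theorem hasSum_threeFTwo_one {a b c s : ℂ} (hc : NotNonposInt c) {n m : ℕ}
    (ha : rising a n ≠ 0) (hb : rising b n ≠ 0)
    (hs : HasSum (fun k : ℕ => rising a k * rising b k / rising c k *
      (rising (k + 1 - n) n / ((k + m + n).factorial : ℂ))) s) :
    HasSum (hypTerm [a + n, b + n, 1 + n] [c + n, 1 + m + 2 * n] 1)
      (((2 * n + m).factorial : ℂ) * rising c n /
            ((n.factorial : ℂ) * rising a n * rising b n) * s) := by
  have h1 := (hasSum_nat_add_iff' n).2 hs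
  rw [Finset.sum_eq_zero, sub_zero] at h1
  · refine (h1.mul_left _).congr_fun fun i => ?_
    have e1 : ∀ x : ℂ, rising x (i + n) = rising x n * rising (x + n) i := fun x => by
      rw [add_comm, rising_add]
    have e4 : ((i + n : ℕ) : ℂ) + 1 - n = i + 1 := by push_cast; ring
    have e2 := rising_natCast_add_one i n
    have e3 := rising_natCast_add_one n i
    have e5 := rising_natCast_add_one (2 * n + m) i
    rw [add_comm n i, ← e2, add_comm (n : ℂ) 1] at e3
    rw [show 2 * n + m + i = i + n + m + n by ring,
      show ((2 * n + m : ℕ) : ℂ) + 1 = 1 + m + 2 * n by push_cast; ring] at e5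
    have h2 := rising_ne_zero hc n
    have h3 := rising_ne_zero (hc.add_natCast n) i
    have h4 : ((n).factorial : ℂ) ≠ 0 := by exact_mod_cast (n).factorial_ne_zero
    have h5 : ((2 * n + m).factorial : ℂ) ≠ 0 := by
      exact_mod_cast (2 * n + m).factorial_ne_zero
    have h6 : ((i).factorial : ℂ) ≠ 0 := by exact_mod_cast (i).factorial_ne_zero
    have h7 : rising ((1 : ℂ) + m + 2 * n) i ≠ 0 :=
      rising_ne_zero (notNonposInt_of_re_pos (by simp; positivity)) i
    have e6 : rising ((i : ℂ) + 1) n = rising (1 + n) i * n.factorial / i.factorial := by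
      rw [e3]; field_simp
    simp only [hypTerm, List.map_cons, List.map_nil, List.prod_cons, List.prod_nil, one_pow,
      mul_one]
    rw [e4, e1, e1, e1, ← e5, e6]
    field_simp
  · intro k hk
    have hk : k < n := Finset.mem_range.1 hk
    have : (k : ℂ) + 1 - n = -((n - 1 - k : ℕ) : ℂ) := by
      rw [Nat.cast_sub (by omega), Nat.cast_sub (by omega)]
      push_cast
      ring
    rw [this, rising_neg_natCast _ _ (by omega)]
    simp

theorem threeFTwo_one_sum (n m : ℕ) (a b c : ℂ) (h : 0 < (c - a - b).re)
    (hc : NotNonposInt (c - n - m))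
    (hab : ∀ i < 2 * n + m, a ≠ n + m - i ∧ b ≠ n + m - i) :
    HypConverges [a + n, b + n, 1 + n] [c + n, 1 + m + 2 * n] 1 ∧
    hyp [a + n, b + n, 1 + n] [c + n, 1 + m + 2 * n] 1 =
      ((2 * n + m).factorial : ℂ) * rising c n /
          ((n.factorial : ℂ) * rising a n * rising b n) *
        ∑ j ∈ Finset.range (n + 1),
          (-1) ^ j * (n.choose j : ℂ) *
            (rising (n + m) j * rising (c - j - m) (j + m) /
              (rising (a - j - m) (j + m) * rising (b - j - m) (j + m))) *
            (Complex.Gamma (c - j - m) * Complex.Gamma (c - a - b + m + j) /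
                (Complex.Gamma (c - a) * Complex.Gamma (c - b)) -
              ∑ k ∈ Finset.range (j + m),
                rising (a - m - j) k * rising (b - m - j) k /
                  ((k.factorial : ℂ) * rising (c - m - j) k)) := by
  have hc0 : NotNonposInt c := by
    simpa using (hc.add_natCast m).add_natCast n
  have hcj : ∀ j ≤ n, NotNonposInt (c - (m + j : ℕ)) := fun j hj => by
    have := hc.add_natCast (n - j)
    rw [Nat.cast_sub hj] at this
    convert this using 1
    push_cast
    ring
  have hrise : ∀ x : ℂ, (∀ i < 2 * n + m, x ≠ n + m - i) →
      rising x n ≠ 0 ∧ ∀ j ≤ n, rising (x - (m + j : ℕ)) (m + j) ≠ 0 := by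
    intro x hx
    -- The excluded values `n + m - i` are the integers from `1 - n` to `n + m`. Index `n + m + i`
    -- encodes `x = -i`, and index `n - j + i` encodes `x = m + j - i`.
    refine ⟨rising_ne_zero_of_forall_lt fun i hi h0 => hx (n + m + i) (by omega) ?_,
      fun j hj => rising_ne_zero_of_forall_lt fun i hi h0 => hx (n - j + i) (by omega) ?_⟩
    · rw [h0]; push_cast; ring
    · rw [Nat.cast_add, Nat.cast_sub hj]
      push_cast at h0
      linear_combination h0
  obtain ⟨ha, haj⟩ := hrise a fun i hi => (hab i hi).1
  obtain ⟨hb, hbj⟩ := hrise b fun i hi => (hab i hi).2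
  refine ⟨hypConverges_of_summable (threeFTwo_one_summable h hc0 n m),
    hyp_eq_of_hasSum (hasSum_threeFTwo_one hc0 ha hb ?_).conditional⟩
  -- The value is left to unification: it is the weighted combination of the truncated Gauss sums
  -- with shift `m + j`.
  have key : HasSum (fun k : ℕ => ∑ j ∈ Finset.range (n + 1),
      ((-1) ^ j * (n.choose j : ℂ) * rising (n + m) j) *
        (rising a k * rising b k / (rising c k * ((k + (m + j)).factorial : ℂ)))) _ :=
    hasSum_sum fun j hj => (hasSum_gauss_shift h (hcj j (Nat.lt_succ_iff.1 (Finset.mem_range.1 hj)))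
      (haj j (Nat.lt_succ_iff.1 (Finset.mem_range.1 hj)))
      (hbj j (Nat.lt_succ_iff.1 (Finset.mem_range.1 hj)))).mul_left
        ((-1) ^ j * (n.choose j : ℂ) * rising (n + m) j)
  convert key using 1
  · ext k
    rw [← sum_choose_div_factorial, Finset.mul_sum]
    refine Finset.sum_congr rfl fun j _ => ?_
    ring
  · refine Finset.sum_congr rfl fun j _ => ?_
    have e : ∀ x : ℂ, x - j - m = x - (m + j : ℕ) ∧ x - m - j = x - (m + j : ℕ) := fun x => by
      constructor <;> push_cast <;> ring
    simp only [(e _).1, (e _).2, add_comm j m, hypTerm, List.map_cons, List.map_nil,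
      List.prod_cons, List.prod_nil, one_pow, mul_one]
    rw [show c - a - b + m + j = c - a - b + (m + j : ℕ) by push_cast; ring]
    have e2 : ∀ x y z : ℂ, x / (y * z) = x / z * (1 / y) := fun x y z => by
      rw [div_mul_div_comm, mul_one, mul_comm y z]
    simp only [← e2]
    ring

theorem mainTheorem3 :
    -- the integral against the beta density, in terms of a `₃F₂` at `1`
    (∀ (a b c : ℂ) (f d : ℝ) (j : ℕ), 0 < f → 0 < d → 0 < (c - a - b).re → NotNonposInt c →
      IntervalIntegrable (hypJacobiBeta a b c j f d) MeasureTheory.volume 0 1 ∧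
      HypConverges [a + j, b + j, f + j] [c + j, d + f + 2 * j] 1 ∧
      ∫ x in (0 : ℝ)..1, hypJacobiBeta a b c j f d x =
        rising f j * rising d j * rising a j * rising b j /
            ((j.factorial : ℂ) * rising (f + d) (2 * j) * rising c j) *
          hyp [a + j, b + j, f + j] [c + j, d + f + 2 * j] 1) ∧
    -- the case in which the third parameter of `₂F₁` is the first parameter of the density
    (∀ (a b : ℂ) (c d : ℝ) (j : ℕ), 0 < c → 0 < d → 0 < ((c : ℂ) - a - b).re →
      rising (d + c - a) j ≠ 0 → rising (d + c - b) j ≠ 0 →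
      IntervalIntegrable (hypJacobiBeta a b c j c d) MeasureTheory.volume 0 1 ∧
      ∫ x in (0 : ℝ)..1, hypJacobiBeta a b c j c d x =
        rising d j * rising a j * rising b j /
            ((j.factorial : ℂ) * rising (d + c - a) j * rising (d + c - b) j) *
          (Complex.Gamma (c + d) * Complex.Gamma (d + c - a - b) /
            (Complex.Gamma (d + c - a) * Complex.Gamma (d + c - b)))) ∧
    -- the identities for `₄F₃` at `1`
    (∀ a b c d : ℂ, 0 < (c - a - b).re → NotNonposInt c →
      NotNonposInt (c + d - a) → NotNonposInt (c + d - b) →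
      HypConverges [a, b, d, c + d - 1] [c, c + d - a, c + d - b] 1 ∧
      HypConverges [a + 1, b + 1, d + 1, c + d] [c + 1, c + d - a + 1, c + d - b + 1] 1 ∧
      Complex.Gamma c * Complex.Gamma (c - a - b) *
            Complex.Gamma (c + d - a) * Complex.Gamma (c + d - b) /
          (Complex.Gamma (c - a) * Complex.Gamma (c - b) *
            Complex.Gamma (c + d) * Complex.Gamma (c + d - a - b)) =
        hyp [a, b, d, c + d - 1] [c, c + d - a, c + d - b] 1 +
          2 * a * b * d / (c * (c + d - a) * (c + d - b)) *
            hyp [a + 1, b + 1, d + 1, c + d] [c + 1, c + d - a + 1, c + d - b + 1] 1) ∧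
    -- the identities for `₃F₂` at `-1`; the disjunction says that the series converge,
    -- either because of the size of the parameters or because they terminate
    (∀ a b c d : ℂ, 0 < (c - a - b).re →
      NotNonposInt (c + d - a) → NotNonposInt (c + d - b) →
      (-1 < (c + d - 2 * a - 2 * b).re ∨
        ∃ k : ℕ, a + 1 = -(k : ℂ) ∨ b + 1 = -(k : ℂ) ∨ c + d = -(k : ℂ)) →
      HypConverges [a, b, c + d - 1] [c + d - a, c + d - b] (-1) ∧
      HypConverges [a + 1, b + 1, c + d] [c + d - a + 1, c + d - b + 1] (-1) ∧
      Complex.Gamma (c + d - a) * Complex.Gamma (c + d - b) /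
          (Complex.Gamma (c + d) * Complex.Gamma (c + d - a - b)) =
        hyp [a, b, c + d - 1] [c + d - a, c + d - b] (-1) -
          2 * a * b / ((c + d - a) * (c + d - b)) *
            hyp [a + 1, b + 1, c + d] [c + d - a + 1, c + d - b + 1] (-1)) ∧
    -- the finite sum for a `₃F₂` at `1` with integer parameters
    (∀ (n m : ℕ) (a b c : ℂ), 0 < (c - a - b).re → NotNonposInt (c - n - m) →
      (∀ i < 2 * n + m, a ≠ n + m - i ∧ b ≠ n + m - i) →
      HypConverges [a + n, b + n, 1 + n] [c + n, 1 + m + 2 * n] 1 ∧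
      hyp [a + n, b + n, 1 + n] [c + n, 1 + m + 2 * n] 1 =
        ((2 * n + m).factorial : ℂ) * rising c n /
            ((n.factorial : ℂ) * rising a n * rising b n) *
          ∑ j ∈ Finset.range (n + 1),
            (-1) ^ j * (n.choose j : ℂ) *
              (rising (n + m) j * rising (c - j - m) (j + m) /
                (rising (a - j - m) (j + m) * rising (b - j - m) (j + m))) *
              (Complex.Gamma (c - j - m) * Complex.Gamma (c - a - b + m + j) /
                  (Complex.Gamma (c - a) * Complex.Gamma (c - b)) -
                ∑ k ∈ Finset.range (j + m),
                  rising (a - m - j) k * rising (b - m - j) k /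
                    ((k.factorial : ℂ) * rising (c - m - j) k))) := by
  refine ⟨fun a b c f d j hf hd h hc => ⟨intervalIntegrable_hypJacobiBeta hf hd h hc j,
      hypConverges_of_summable (threeFTwo_summable hf hd h hc j),
      integral_hypJacobiBeta hf hd h hc j⟩,
    fun a b c d j hc hd h ha hb =>
      ⟨intervalIntegrable_hypJacobiBeta hc hd h (notNonposInt_ofReal hc) j,
      integral_hypJacobiBeta_of_eq hc hd h j ha hb⟩,
    fun a b c d h hc hA hB => ⟨hypConverges_of_summable (fourF3_summable h hc hA hB),
      hypConverges_of_summable (fourF3_shift_summable h hc hA hB), vwpFive_sum h hc hA hB⟩,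
    fun a b c d _ hA hB h => ?_, threeFTwo_one_sum⟩
  have hconv := vwpFour_series_converge hA hB h
  exact ⟨hconv.1, hconv.2.1, vwpFour_sum hA hB h⟩
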